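/- Let $N_{\mathbb R}$ be a finite-dimensional real vector space and let $\Sigma$ be a complete simplicial fan in $N_{\mathbb R}$, that is, a finite collection of cones, each generated by a linearly independent set of vectors, closed under taking faces, any two of which meet in a common face, and whose union is $N_{\mathbb R}$. For $\sigma\in\Sigma$ let $\operatorname{st}(\sigma)=\bigcup_{\tau\in\Sigma,\ \sigma\subseteq\tau}\operatorname{relint}(\tau)$ be its (open) star, and let $q_\sigma\colon N_{\mathbb R}\to (N/\sigma)_{\mathbb R}:=N_{\mathbb R}/\mathbb R\sigma$ be the quotient map by the linear span of $\sigma$. Then there exists a collection of smooth maps $\pi_\sigma\colon \operatorname{st}(\sigma)\to\operatorname{relint}(\sigma)$, one for each nonzero cone $\sigma\in\Sigma$, such that: 1. for every $b\in\operatorname{relint}(\sigma)$, the map $q_\sigma$ restricts to a diffeomorphism from the fibre $\pi_\sigma^{-1}(b)$ onto $(N/\sigma)_{\mathbb R}$; 2. for all nonzero cones $\sigma\subseteq\tau$ of $\Sigma$, $\pi_\sigma\circ\pi_\tau=\pi_\sigma|_{\operatorname{st}(\tau)}$; 3. each $\pi_\sigma$ is homogeneous of degree $1$: $\pi_\sigma(tx)=t\,\pi_\sigma(x)$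 for all $t>0$ and $x\in\operatorname{st}(\sigma)$. -/

import Mathlib

open scoped ContDiff

/-- A map defined on a subset `A` of a normed space is smooth on `A` if, near every point of `A`,
it is the restriction of a smooth map defined on an open set. -/
def SmoothOnSubset {E F : Type*} [NormedAddCommGroup E] [NormedSpace ℝ E]
    [NormedAddCommGroup F] [NormedSpace ℝ F] (f : E → F) (A : Set E) : Prop :=
  ∀ x ∈ A, ∃ U : Set E, IsOpen U ∧ x ∈ U ∧
    ∃ g : E → F, ContDiffOn ℝ ∞ g U ∧ Set.EqOn f g (A ∩ U)

/-- `f` restricts to a diffeomorphism from the subset `A` onto the subset `B`: it is a bijection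
from `A` onto `B`, smooth with smooth inverse. If `B` is a vector space, it follows that `A` is a
smooth embedded submanifold of dimension `dim B`. -/
def RestrictsToDiffeo {E F : Type*} [NormedAddCommGroup E] [NormedSpace ℝ E]
    [NormedAddCommGroup F] [NormedSpace ℝ F] (f : E → F) (A : Set E) (B : Set F) : Prop :=
  SmoothOnSubset f A ∧ Set.MapsTo f A B ∧
    ∃ g : F → E, SmoothOnSubset g B ∧ Set.MapsTo g B A ∧ Set.InvOn g f A B

/-- A (finite) simplicial fan in a real vector space: a finite non-empty collection of simplicial
cones (each generated by a finite linearly independent set), closed under passing to faces, in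
which any two cones intersect in a common face. -/
structure SimplicialFan (V : Type*) [AddCommGroup V] [Module ℝ V] where
  cones : Set (PointedCone ℝ V)
  finite_cones : cones.Finite
  nonempty_cones : cones.Nonempty
  isSimplicial : ∀ σ ∈ cones, PointedCone.IsSimplicial σ
  face_mem : ∀ σ ∈ cones, ∀ τ : PointedCone ℝ V, PointedCone.IsFaceOf τ σ → τ ∈ cones
  inter_isFaceOf : ∀ σ ∈ cones, ∀ τ ∈ cones,
    PointedCone.IsFaceOf (σ ⊓ τ) σ ∧ PointedCone.IsFaceOf (σ ⊓ τ) τ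

namespace SimplicialFan

/-- A fan is complete if its cones cover the whole space. -/
def IsComplete {V : Type*} [AddCommGroup V] [Module ℝ V] (S : SimplicialFan V) : Prop :=
  ∀ x : V, ∃ σ ∈ S.cones, x ∈ σ

/-- The relative interior of a cone. -/
def relint {V : Type*} [NormedAddCommGroup V] [NormedSpace ℝ V] (σ : PointedCone ℝ V) : Set V :=
  intrinsicInterior ℝ (σ : Set V)

/-- The (open) star of `σ`: the union of the relative interiors of the cones of the fan that
contain `σ`. -/
def star {V : Type*} [NormedAddCommGroup V] [NormedSpace ℝ V] (S : SimplicialFan V)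
    (σ : PointedCone ℝ V) : Set V :=
  {x | ∃ τ ∈ S.cones, σ ≤ τ ∧ x ∈ relint τ}

/-- The linear span `ℝσ` of a cone; `V ⧸ linSpan σ` is `(N/σ)_ℝ` when `V = N_ℝ`. -/
def linSpan {V : Type*} [AddCommGroup V] [Module ℝ V] (σ : PointedCone ℝ V) : Submodule ℝ V :=
  Submodule.span ℝ (σ : Set V)

/-- Linear spans of cones are closed; this makes the quotient a normed space. -/
instance isClosed_linSpan {V : Type*} [NormedAddCommGroup V] [NormedSpace ℝ V]
    [FiniteDimensional ℝ V] (σ : PointedCone ℝ V) : IsClosed (linSpan σ : Set V) :=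
  Submodule.closed_of_finiteDimensional _

/-- A coherent collection of projections `π σ : star σ → relint σ`, indexed by the nonzero cones of
the fan (the values of `π σ` outside `star σ`, and of `π` at other cones, are irrelevant). -/
structure IsCoherentProjections {V : Type*} [NormedAddCommGroup V] [NormedSpace ℝ V]
    [FiniteDimensional ℝ V] (S : SimplicialFan V) (π : PointedCone ℝ V → V → V) : Prop where
  mapsTo : ∀ σ ∈ S.cones, σ ≠ ⊥ → Set.MapsTo (π σ) (S.star σ) (relint σ)
  smooth : ∀ σ ∈ S.cones, σ ≠ ⊥ → SmoothOnSubset (π σ) (S.star σ)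
  fibre_diffeo : ∀ σ ∈ S.cones, σ ≠ ⊥ → ∀ b ∈ relint σ,
    RestrictsToDiffeo (fun x => (linSpan σ).mkQ x) {x ∈ S.star σ | π σ x = b} Set.univ
  comp_eq : ∀ σ ∈ S.cones, ∀ τ ∈ S.cones, σ ≠ ⊥ → σ ≤ τ →
    ∀ x ∈ S.star τ, π σ (π τ x) = π σ x

/-- Each `π σ` is homogeneous of degree `1` on the star of `σ`. -/
def IsHomogeneousDegreeOne {V : Type*} [NormedAddCommGroup V] [NormedSpace ℝ V]
    (S : SimplicialFan V) (π : PointedCone ℝ V → V → V) : Prop :=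
  ∀ σ ∈ S.cones, σ ≠ ⊥ → ∀ t : ℝ, 0 < t → ∀ x ∈ S.star σ, π σ (t • x) = t • π σ x

end SimplicialFan

/-! Let `u i` be the unit vectors on the rays and `φ i` the piecewise linear coordinates of the fan,
so that x = ∑ φ_i(x) u_i. The map x ↦ ∑ φ_i(x) u_i, summed over the rays of σ only, has every
required property except smoothness. The proof replaces φ_i by a smooth height f_i on the open star
of the i-th ray, homogeneous of degree 1, and lets π_σ(x) be the unique point of relint σ with the
same heights as x for all rays of σ. Since f_i depends on the ray alone and not on σ, coherence is
immediate; homogeneity is inherited from the f_i.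

Everything rests on one fact: on the part of st(σ) in any coset of ℝσ, the heights (f_i), i a ray of
σ, form a diffeomorphism onto the open positive orthant. The coset ℝσ itself yields π_σ, and letting
the coset vary yields the fibres.

Let M_i be φ_i mollified at a small scale δ, and let f_i be homogeneous with {f_i = 1} = {M_i = 1}.
Shrinking δ gives no small ordinary Lipschitz constant for φ_i - M_i. But raising coordinates that
already exceed θ = Kδ, with K a Lipschitz constant of the φ_i, changes φ_i and M_i equally, so the
error sees only the coordinates truncated at θ. Hence it is Lipschitz with a small constant η in the
logarithms of the coordinates (`exists_smoothing`). In these logarithms, prescribing heights is a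
fixed point problem for a contraction (`exists_f_eq`); the same estimate gives uniqueness
(`eq_of_f_eq`) and, infinitesimally, injective derivatives (`eq_zero_of_fderiv_f_eq_zero`), so the
inverse is smooth (`Smoothing.exists_smooth_inverse`). -/

open Set Filter Topology Metric

/-! ### Analytic tools: mollification, smooth inverses, Lipschitz gluing -/

/-- Averaging operators at a small scale: they produce smooth functions, kill `0`, and preserve
inequalities that hold on balls of radius `δ`. -/
theorem exists_mollifier {V : Type*} [NormedAddCommGroup V] [NormedSpace ℝ V]
    [FiniteDimensional ℝ V] {δ : ℝ} (hδ : 0 < δ) :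
    ∃ A : (V → ℝ) → V → ℝ, (∀ f, Continuous f → ContDiff ℝ ∞ (A f)) ∧
      (∀ x, A (fun _ => 0) x = 0) ∧
      ∀ f g, Continuous f → Continuous g → ∀ (a b : ℝ) (x y : V),
        (∀ v ∈ ball (0 : V) δ, a * f (x + v) ≤ g (y + v) + b) → a * A f x ≤ A g y + b := by
  borelize V
  let φ : ContDiffBump (0 : V) := ⟨δ / 2, δ, half_pos hδ, half_lt_self hδ⟩
  let μ : MeasureTheory.Measure V := .addHaar
  have hint : ∀ f : V → ℝ, Continuous f → ∀ x : V,
      MeasureTheory.Integrable (fun t => φ.normed μ t * f (x - t)) μ := by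
    intro f hf x
    refine Continuous.integrable_of_hasCompactSupport (φ.continuous_normed.mul (by fun_prop)) ?_
    exact φ.hasCompactSupport_normed.mul_right
  refine ⟨fun f x => ∫ t, φ.normed μ t * f (x - t) ∂μ, ?_, ?_, ?_⟩
  · intro f hf
    have := φ.hasCompactSupport_normed (μ := μ).contDiff_convolution_left
      (ContinuousLinearMap.mul ℝ ℝ) (n := ⊤) φ.contDiff_normed (hf.locallyIntegrable (μ := μ))
    exact this
  · intro x
    simp
  · intro f g hf hg a b x y h
    have h1 : ∫ t, φ.normed μ t ∂μ = 1 := φ.integral_normed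
    calc a * ∫ t, φ.normed μ t * f (x - t) ∂μ
        = ∫ t, a * (φ.normed μ t * f (x - t)) ∂μ :=
          (MeasureTheory.integral_const_mul _ _).symm
      _ ≤ ∫ t, (φ.normed μ t * g (y - t) + φ.normed μ t * b) ∂μ := by
          refine MeasureTheory.integral_mono ((hint f hf x).const_mul a)
            ((hint g hg y).add (φ.integrable_normed.mul_const b)) fun t => ?_
          by_cases ht : t ∈ ball (0 : V) δ
          · have := h (-t) (by simpa using ht)
            simp only [← sub_eq_add_neg] at this
            have h0 := φ.nonneg_normed (μ := μ) t
            dsimp only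
            nlinarith
          · have : φ.normed μ t = 0 := by
              rw [← Function.notMem_support, φ.support_normed_eq]
              exact ht
            simp [this]
      _ = (∫ t, φ.normed μ t * g (y - t) ∂μ) + b := by
          rw [MeasureTheory.integral_add (hint g hg y) (φ.integrable_normed.mul_const b),
            MeasureTheory.integral_mul_const, h1, one_mul]

/-- A left inverse of a smooth injective map with injective derivatives between spaces of the same
dimension is smooth. -/
theorem contDiffAt_leftInverse {E F : Type*} [NormedAddCommGroup E] [NormedSpace ℝ E]
    [FiniteDimensional ℝ E] [NormedAddCommGroup F] [NormedSpace ℝ F] [FiniteDimensional ℝ F]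
    (hdim : Module.finrank ℝ E = Module.finrank ℝ F) {f : E → F} {g : F → E} {U : Set E}
    (hU : IsOpen U) (hg : ∀ x ∈ U, g (f x) = x) {x : E} (hx : x ∈ U)
    (hf : ContDiffAt ℝ ∞ f x) (hf' : ∀ v, fderiv ℝ f x v = 0 → v = 0) :
    ContDiffAt ℝ ∞ g (f x) := by
  have : CompleteSpace E := FiniteDimensional.complete ℝ E
  have hinj : Function.Injective (fderiv ℝ f x).toLinearMap :=
    (injective_iff_map_eq_zero _).2 hf'
  let e : E ≃L[ℝ] F :=
    (LinearEquiv.ofInjectiveOfFinrankEq (fderiv ℝ f x).toLinearMap hinj hdim).toContinuousLinearEquiv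
  have he : HasFDerivAt f (e : E →L[ℝ] F) x := by
    have h := (hf.differentiableAt (by simp)).hasFDerivAt
    convert h using 1
    ext v
    rfl
  have hn : (∞ : WithTop ℕ∞) ≠ 0 := by simp
  refine (hf.to_localInverse he hn).congr_of_eventuallyEq ?_
  have hs := hf.hasStrictFDerivAt' he hn
  have h1 : ∀ᶠ y in 𝓝 (f x), f (hs.localInverse f e x y) = y := hs.eventually_right_inverse
  have h2 : ∀ᶠ y in 𝓝 (f x), hs.localInverse f e x y ∈ U :=
    hs.localInverse_tendsto (hU.mem_nhds hx)
  filter_upwards [h1, h2] with y hy1 hy2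
  have := hg _ hy2
  rw [hy1] at this
  exact this

/-- A function that is `K`-Lipschitz on each member of a finite closed cover of a normed space is
`K`-Lipschitz. -/
theorem lipschitz_of_finite_closed_cover {V ι : Type*} [NormedAddCommGroup V] [NormedSpace ℝ V]
    [Finite ι] {f : V → ℝ} {C : ι → Set V} (hC : ∀ i, IsClosed (C i)) (hcov : ∀ x, ∃ i, x ∈ C i)
    {K : ℝ} (hK : 0 ≤ K) (hf : ∀ i, ∀ x ∈ C i, ∀ y ∈ C i, |f x - f y| ≤ K * ‖x - y‖) (x y : V) :
    |f x - f y| ≤ K * ‖x - y‖ := by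
  have hcont : Continuous f := by
    refine (locallyFinite_of_finite C).continuous (eq_univ_of_forall fun x => ?_) hC fun i => ?_
    · simpa using hcov x
    · have : LipschitzOnWith ⟨K, hK⟩ f (C i) := LipschitzOnWith.of_dist_le_mul fun x hx y hy => by
        rw [Real.dist_eq, dist_eq_norm]
        exact hf i x hx y hy
      exact this.continuousOn
  have key : ∀ x y : V, f y - f x ≤ K * ‖x - y‖ := by
    intro x y
    let γ : ℝ → V := fun t => x + t • (y - x)
    have hγ : Continuous γ := by fun_prop
    have hslope : ∀ t : ℝ, ∀ r, K * ‖x - y‖ < r →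
        ∃ᶠ z in 𝓝[>] t, slope (f ∘ γ) t z < r := by
      intro t r hr
      -- Pigeonhole: one of the finitely many closed sets is met at points arbitrarily close to `t`
      -- on the right, hence also contains `γ t`. This bounds a lower right derivative, which
      -- suffices for the mean value inequality.
      have hex : ∃ i, ∃ᶠ z in 𝓝[>] t, γ z ∈ C i := by
        by_contra! hcon
        have h1 : ∀ i, ∀ᶠ z in 𝓝[>] t, γ z ∉ C i := fun i => by
          simpa [Filter.not_frequently] using hcon i
        obtain ⟨z, hz⟩ := (eventually_all.2 h1).exists
        obtain ⟨i, hi⟩ := hcov (γ z)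
        exact hz i hi
      obtain ⟨i, hi⟩ := hex
      have ht : γ t ∈ C i := (hC i).mem_of_frequently_of_tendsto hi
        (hγ.continuousAt.mono_left nhdsWithin_le_nhds)
      refine (hi.and_eventually self_mem_nhdsWithin).mono fun z hz => ?_
      have hzt : 0 < z - t := sub_pos.2 hz.2
      have h1 := (le_abs_self _).trans (hf i _ hz.1 _ ht)
      have h2 : γ z - γ t = (z - t) • (y - x) := by
        simp only [γ]; module
      rw [h2, norm_smul, Real.norm_of_nonneg hzt.le, norm_sub_rev y x] at h1
      rw [slope_def_field, div_lt_iff₀ hzt]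
      simp only [Function.comp]
      nlinarith
    have := image_le_of_liminf_slope_right_le_deriv_boundary (f := f ∘ γ) (a := 0) (b := 1)
      (B := fun t => f x + t * (K * ‖x - y‖)) (B' := fun _ => K * ‖x - y‖)
      (by fun_prop) (by simp [γ]) (by fun_prop)
      (fun t _ => by
        simpa using (((hasDerivAt_id t).mul_const (K * ‖x - y‖)).const_add (f x)).hasDerivWithinAt)
      (fun t _ r hr => hslope t r hr) (right_mem_Icc.2 zero_le_one)
    simp only [γ, Function.comp, one_smul, add_sub_cancel, one_mul] at this
    linarith
  rw [abs_le]
  have h1 := key x y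
  have h2 := key y x
  rw [norm_sub_rev] at h2
  constructor <;> linarith

open Classical in
theorem LinearIndependent.exists_dual_family {ι K V : Type*} [Field K] [AddCommGroup V]
    [Module K V] {v : ι → V} (hv : LinearIndependent K v) :
    ∃ l : ι → V →ₗ[K] K, ∀ i j, l i (v j) = if j = i then 1 else 0 := by
  let b := Module.Basis.sumExtend hv
  refine ⟨fun i => b.coord (Sum.inl i), fun i j => ?_⟩
  have h : v j = b (Sum.inl j) := by
    simp [b, Module.Basis.sumExtend]
    rfl
  rw [h, Module.Basis.coord_apply, Module.Basis.repr_self, Finsupp.single_apply]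
  simp

/-! ### Piecewise linear coordinates -/

/-- Piecewise linear coordinates on `V` with respect to finitely many vectors `u i`: the
coordinates `φ i x` are nonnegative, reconstruct `x`, and behave additively along the generators
of the cone spanned by the `u i` with `φ i x ≠ 0`. -/
structure ConicalCoordinates (I V : Type*) [Fintype I] [NormedAddCommGroup V]
    [NormedSpace ℝ V] where
  u : I → V
  φ : I → V → ℝ
  norm_u_le : ∀ i, ‖u i‖ ≤ 1
  nonneg : ∀ i x, 0 ≤ φ i x
  sum_smul : ∀ x, ∑ i, φ i x • u i = x
  apply_sum : ∀ (x : V) (s : I → ℝ), (∀ j, 0 ≤ s j) → (∀ j, φ j x = 0 → s j = 0) →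
    ∀ i, φ i (∑ j, s j • u j) = s i

namespace ConicalCoordinates

variable {I V : Type*} [Fintype I] [NormedAddCommGroup V] [NormedSpace ℝ V]
  (C : ConicalCoordinates I V)

theorem apply_add_sum (x : V) (d : I → ℝ) (hd : ∀ j, 0 ≤ C.φ j x + d j)
    (h : ∀ j, C.φ j x = 0 → d j = 0) (i : I) :
    C.φ i (x + ∑ j, d j • C.u j) = C.φ i x + d i := by
  have h1 : x + ∑ j, d j • C.u j = ∑ j, (C.φ j x + d j) • C.u j := by
    simp_rw [add_smul, Finset.sum_add_distrib, C.sum_smul]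
  rw [h1, C.apply_sum x _ hd]
  intro j hj
  rw [hj, h j hj, add_zero]

theorem apply_smul {r : ℝ} (hr : 0 ≤ r) (x : V) (i : I) : C.φ i (r • x) = r * C.φ i x := by
  have h1 : r • x = ∑ j, (r * C.φ j x) • C.u j := by
    conv_lhs => rw [← C.sum_smul x, Finset.smul_sum]
    simp_rw [smul_smul]
  rw [h1, C.apply_sum x _ fun j => mul_nonneg hr (C.nonneg j x)]
  intro j hj
  rw [hj, mul_zero]

/-- `A` is a face if it is the set of nonzero coordinates of some point. -/
def IsFace (A : Finset I) : Prop := ∃ x, ∀ j, 0 < C.φ j x ↔ j ∈ A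

/-- The open star of a set of generators. -/
def star (A : Finset I) : Set V := {x | ∀ i ∈ A, 0 < C.φ i x}

variable {C} {A : Finset I}

theorem IsFace.apply_sum (hA : C.IsFace A) (s : I → ℝ) (hs : ∀ j ∈ A, 0 ≤ s j) (i : I) :
    (i ∈ A → C.φ i (∑ j ∈ A, s j • C.u j) = s i) ∧
      (i ∉ A → C.φ i (∑ j ∈ A, s j • C.u j) = 0) := by
  classical
  obtain ⟨x, hx⟩ := hA
  have h1 : ∑ j ∈ A, s j • C.u j = ∑ j, (if j ∈ A then s j else 0) • C.u j := by
    simp [ite_smul, Finset.sum_ite_mem]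
  have h2 := C.apply_sum x (fun j => if j ∈ A then s j else 0)
    (fun j => by split_ifs with h <;> [exact hs j h; exact le_rfl])
    (fun j hj => by
      have : j ∉ A := fun h => ((hx j).2 h).ne' hj
      simp [this]) i
  rw [h1, h2]
  constructor <;> intro h <;> simp [h]

/-- The positive and negative parts of a linear relation are two nonnegative combinations of the
same point, and the coordinates recover the coefficients of both. -/
theorem IsFace.linearIndependent (hA : C.IsFace A) :
    LinearIndependent ℝ (fun i : A => C.u i) := by
  classical
  rw [Fintype.linearIndependent_iff]
  intro g hg i
  let e : I → ℝ := fun j => if h : j ∈ A then g ⟨j, h⟩ else 0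
  have he : ∑ j ∈ A, e j • C.u j = 0 := by
    rw [← hg, ← Finset.sum_coe_sort]
    exact Finset.sum_congr rfl fun j _ => by simp [e]
  have h1 : ∑ j ∈ A, max (e j) 0 • C.u j = ∑ j ∈ A, max (-e j) 0 • C.u j := by
    rw [← sub_eq_zero, ← Finset.sum_sub_distrib, ← he]
    refine Finset.sum_congr rfl fun j _ => ?_
    rw [← sub_smul]
    congr 1
    rcases le_total (e j) 0 with h | h
    · rw [max_eq_right h, max_eq_left (by linarith)]; ring
    · rw [max_eq_left h, max_eq_right (by linarith)]; ring
  have h2 := (hA.apply_sum (fun j => max (e j) 0) (fun j _ => le_max_right _ _) i).1 i.2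
  have h3 := (hA.apply_sum (fun j => max (-e j) 0) (fun j _ => le_max_right _ _) i).1 i.2
  rw [h1, h3] at h2
  have h4 : e i = g i := by simp [e]
  rw [← h4]
  rcases le_total (e i) 0 with h | h
  · rw [max_eq_right h, max_eq_left (by linarith)] at h2; linarith
  · rw [max_eq_left h, max_eq_right (by linarith)] at h2; linarith

theorem IsFace.exists_dual [FiniteDimensional ℝ V] (hA : C.IsFace A) :
    ∃ l : I → V →L[ℝ] ℝ, ∀ i ∈ A, ∀ (s : I → ℝ), l i (∑ j ∈ A, s j • C.u j) = s i := by
  classical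
  obtain ⟨l, hl⟩ := hA.linearIndependent.exists_dual_family
  refine ⟨fun i => if h : i ∈ A then LinearMap.toContinuousLinearMap (l ⟨i, h⟩) else 0,
    fun i hi s => ?_⟩
  simp only [hi, dite_true, LinearMap.coe_toContinuousLinearMap', map_sum, map_smul]
  rw [← Finset.sum_coe_sort, Finset.sum_eq_single ⟨i, hi⟩]
  · rw [hl]; simp
  · intro j _ hj
    rw [hl, if_neg hj, smul_zero]
  · simp

/-- The set of nonzero coordinates of a point is a face. -/
theorem isFace_support (x : V) : C.IsFace (Finset.univ.filter fun i => 0 < C.φ i x) :=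
  ⟨x, fun j => by simp⟩

theorem sum_support {x : V} (h : ∀ j, j ∉ A → C.φ j x = 0) : ∑ j ∈ A, C.φ j x • C.u j = x := by
  conv_rhs => rw [← C.sum_smul x]
  refine Finset.sum_subset (Finset.subset_univ _) fun j _ hj => ?_
  rw [h j hj, zero_smul]

-- On the closed cone spanned by a face, each coordinate is linear or zero; these finitely many
-- cones cover the space.
variable (C) in
theorem exists_lipschitz [FiniteDimensional ℝ V] :
    ∃ K : ℝ, 1 ≤ K ∧ ∀ i x y, |C.φ i x - C.φ i y| ≤ K * ‖x - y‖ := by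
  classical
  choose l hl using fun A : {A : Finset I // C.IsFace A} => A.2.exists_dual
  obtain ⟨K, hK⟩ := (Set.finite_range fun p : {A : Finset I // C.IsFace A} × I =>
    ‖l p.1 p.2‖).bddAbove
  refine ⟨max K 1, le_max_right _ _, fun i => ?_⟩
  let D : {A : Finset I // C.IsFace A} → Set V := fun A => {x | ∀ j, j ∉ A.1 → C.φ j x = 0}
  have hφl : ∀ A, ∀ x ∈ D A, ∀ j ∈ A.1, C.φ j x = l A j x := by
    intro A x hx j hj
    conv_rhs => rw [← sum_support hx, hl A j hj]
  refine lipschitz_of_finite_closed_cover (C := D) (fun A => ?_) (fun x => ?_)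
    (zero_le_one.trans (le_max_right _ _)) (fun A x hx y hy => ?_)
  · have : D A = {x | ∑ j ∈ A.1, l A j x • C.u j = x} ∩ ⋂ j ∈ A.1, {x | 0 ≤ l A j x} := by
      ext x
      simp only [mem_inter_iff, mem_ofPred_eq, mem_iInter]
      constructor
      · intro hx
        refine ⟨?_, fun j hj => hφl A x hx j hj ▸ C.nonneg j x⟩
        conv_rhs => rw [← sum_support hx]
        exact Finset.sum_congr rfl fun j hj => by rw [hφl A x hx j hj]
      · rintro ⟨h1, h2⟩ j hj
        rw [← h1]
        exact (A.2.apply_sum (fun j => l A j x) h2 j).2 hj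
    rw [this]
    exact (isClosed_eq (by fun_prop) continuous_id).inter
      (isClosed_biInter fun j _ => isClosed_le continuous_const (l A j).continuous)
  · refine ⟨⟨_, isFace_support x⟩, fun j hj => ?_⟩
    have := C.nonneg j x
    simp only [Finset.mem_filter, Finset.mem_univ, true_and, not_lt] at hj
    exact le_antisymm hj this
  · by_cases hi : i ∈ A.1
    · rw [hφl A x hx i hi, hφl A y hy i hi, ← map_sub, ← Real.norm_eq_abs]
      refine ((l A i).le_opNorm _).trans (mul_le_mul_of_nonneg_right ?_ (norm_nonneg _))
      exact (hK ⟨(A, i), rfl⟩).trans (le_max_left _ _)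
    · rw [hx i hi, hy i hi, sub_zero, abs_zero]
      exact mul_nonneg (zero_le_one.trans (le_max_right _ _)) (norm_nonneg _)

theorem continuous_φ [FiniteDimensional ℝ V] (i : I) : Continuous (C.φ i) := by
  obtain ⟨K, hK, h⟩ := C.exists_lipschitz
  exact (LipschitzWith.of_dist_le_mul (K := ⟨K, zero_le_one.trans hK⟩) fun x y => by
    rw [Real.dist_eq, dist_eq_norm]
    exact h i x y).continuous

theorem isOpen_star [FiniteDimensional ℝ V] (A : Finset I) : IsOpen (C.star A) := by
  have : C.star A = ⋂ i ∈ A, {x | 0 < C.φ i x} := by ext; simp [star]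
  rw [this]
  exact isOpen_biInter_finset fun i _ => isOpen_lt continuous_const (continuous_φ i)

end ConicalCoordinates

/-! ### Mollified coordinates and their error in logarithmic scale -/

/-- Truncation at `θ` is `θ`-Lipschitz for relative distance; this factor makes the error of the
smoothing small. -/
theorem abs_min_sub_min_le {a b θ : ℝ} (ha : 0 ≤ a) (hb : 0 ≤ b) (hθ : 0 ≤ θ) :
    |min a θ - min b θ| ≤ θ * (|a - b| / max a b) := by
  wlog h : a ≤ b generalizing a b
  · rw [abs_sub_comm, abs_sub_comm a, max_comm]
    exact this hb ha (le_of_not_ge h)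
  rw [max_eq_right h, abs_sub_comm, abs_sub_comm a, abs_of_nonneg (sub_nonneg.2 h),
    abs_of_nonneg (sub_nonneg.2 (min_le_min_right _ h))]
  rcases hb.eq_or_lt with rfl | hb
  · have : a = 0 := le_antisymm h ha
    simp [this]
  rw [← mul_div_assoc, le_div_iff₀ hb]
  rcases le_total a θ with h1 | h1 <;> rcases le_total b θ with h2 | h2 <;>
    simp only [h1, h2, min_eq_left, min_eq_right] <;> nlinarith

namespace ConicalCoordinates

variable {I V : Type*} [Fintype I] [NormedAddCommGroup V] [NormedSpace ℝ V]

/-- Smooth functions approximating the coordinates `φ i`. The errors `φ i - M i` are bounded and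
have small Lipschitz constants in logarithmic coordinates. -/
structure Smoothing (C : ConicalCoordinates I V) (η : ℝ) where
  M : I → V → ℝ
  contDiff : ∀ i, ContDiff ℝ ∞ (M i)
  abs_sub_le : ∀ i x, |M i x - C.φ i x| ≤ 1 / 4
  radial : ∀ i z r, 1 ≤ r → (r - 1) * (M i z - 1 / 4) ≤ M i (r • z) - M i z
  error_lipschitz : ∀ i x y, |(C.φ i x - M i x) - (C.φ i y - M i y)| ≤
    η * ∑ j, |C.φ j x - C.φ j y| / max (C.φ j x) (C.φ j y)

theorem exists_smoothing [FiniteDimensional ℝ V] (C : ConicalCoordinates I V) {η : ℝ}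
    (hη : 0 < η) : Nonempty (C.Smoothing η) := by
  obtain ⟨K, hK, hφ⟩ := C.exists_lipschitz
  have hK0 : 0 < K := zero_lt_one.trans_le hK
  -- The first bound keeps `M i` within 1/4 of `φ i` and gives the radial estimate. In the second,
  -- 2K is a Lipschitz constant of the error and Kδ is the truncation height.
  obtain ⟨δ, hδ, hδ1, hδ2⟩ : ∃ δ > 0, K * δ ≤ 1 / 4 ∧ 2 * K * (K * δ) ≤ η := by
    refine ⟨min (1 / (4 * K)) (η / (2 * K * K)), by positivity, ?_, ?_⟩
    · have := min_le_left (1 / (4 * K)) (η / (2 * K * K))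
      rw [le_div_iff₀ (by positivity)] at this
      linarith
    · have := min_le_right (1 / (4 * K)) (η / (2 * K * K))
      rw [le_div_iff₀ (by positivity)] at this
      linarith
  obtain ⟨A, hA, hA0, hAle⟩ := exists_mollifier (V := V) hδ
  have hc : ∀ i, Continuous (C.φ i) := fun i => continuous_φ i
  have hlip : ∀ i x y, A (C.φ i) x ≤ A (C.φ i) y + K * ‖x - y‖ := by
    intro i x y
    have := hAle (C.φ i) (C.φ i) (hc i) (hc i) 1 (K * ‖x - y‖) x y fun v _ => by
      have := (abs_le.1 (hφ i (x + v) (y + v))).2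
      rw [add_sub_add_right_eq_sub] at this
      linarith
    linarith
  have hclose : ∀ i x v, ‖v‖ < δ → |C.φ i (x + v) - C.φ i x| ≤ K * δ := by
    intro i x v hv
    have := hφ i (x + v) x
    rw [add_sub_cancel_left] at this
    nlinarith
  set θ := K * δ with hθ
  have hθ0 : 0 ≤ θ := by positivity
  let T : V → V := fun x => ∑ j, min (C.φ j x) θ • C.u j
  have hT : ∀ x j, C.φ j (T x) = min (C.φ j x) θ := fun x j =>
    C.apply_sum x _ (fun k => le_min (C.nonneg k x) hθ0)
      (fun k hk => by rw [hk, min_eq_left hθ0]) j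
  have hTx : ∀ x v, ‖v‖ < δ → ∀ i,
      C.φ i (x + v) = C.φ i (T x + v) + max (C.φ i x - θ) 0 := by
    intro x v hv i
    have h1 : x + v = (T x + v) + ∑ j, max (C.φ j x - θ) 0 • C.u j := by
      have : ∀ j, C.φ j x = min (C.φ j x) θ + max (C.φ j x - θ) 0 := fun j => by
        rcases le_total (C.φ j x) θ with h | h
        · rw [min_eq_left h, max_eq_right (by linarith)]; ring
        · rw [min_eq_right h, max_eq_left (by linarith)]; ring
      rw [add_right_comm]
      congr 1
      conv_lhs => rw [← C.sum_smul x]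
      simp only [T]
      rw [← Finset.sum_add_distrib]
      exact Finset.sum_congr rfl fun j _ => by rw [← add_smul, ← this j]
    rw [h1]
    refine C.apply_add_sum _ _ (fun j => add_nonneg (C.nonneg _ _) (le_max_right _ _))
      (fun j hj => max_eq_right ?_) i
    -- A coordinate exceeding `θ` equals `θ` at `T x`; moving by less than `δ` changes it by less
    -- than Kδ = `θ`, so it stays positive and its generator may be added freely.
    by_contra! hcon
    have h2 := hφ j (T x + v) (T x)
    rw [hj, hT, min_eq_right (by linarith), add_sub_cancel_left, zero_sub, abs_neg,
      abs_of_nonneg hθ0] at h2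
    nlinarith
  have hMT : ∀ x i, A (C.φ i) x = A (C.φ i) (T x) + max (C.φ i x - θ) 0 := by
    intro x i
    refine le_antisymm ?_ ?_
    · have := hAle (C.φ i) (C.φ i) (hc i) (hc i) 1 (max (C.φ i x - θ) 0) x (T x) fun v hv => by
        rw [hTx x v (by simpa using hv) i, one_mul]
      linarith
    · have := hAle (C.φ i) (C.φ i) (hc i) (hc i) 1 (-max (C.φ i x - θ) 0) (T x) x fun v hv => by
        rw [hTx x v (by simpa using hv) i]
        linarith
      linarith
  refine ⟨⟨fun i => A (C.φ i), fun i => hA _ (hc i), fun i x => ?_, fun i z r hr => ?_,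
    fun i x y => ?_⟩⟩
  · have h1 := hAle (C.φ i) (fun _ => 0) (hc i) continuous_const 1 (C.φ i x + θ) x x fun v hv => by
      have := (abs_le.1 (hclose i x v (by simpa using hv))).2
      linarith
    have h2 := hAle (fun _ => 0) (C.φ i) continuous_const (hc i) 1 (-C.φ i x + θ) x x fun v hv => by
      have := (abs_le.1 (hclose i x v (by simpa using hv))).1
      linarith
    rw [hA0] at h1 h2
    rw [abs_le]
    constructor <;> linarith
  · have hr0 : 0 < r := by linarith
    have h1 := hAle (C.φ i) (C.φ i) (hc i) (hc i) r ((r - 1) * θ) z (r • z) fun v hv => by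
      -- Rescaling replaces the displacement `v` by `r⁻¹ • v`; homogeneity of `φ i` and its
      -- Lipschitz bound control the discrepancy.
      have e1 : r • z + v = r • (z + r⁻¹ • v) := by
        rw [smul_add, smul_smul, mul_inv_cancel₀ hr0.ne', one_smul]
      rw [e1, C.apply_smul hr0.le]
      have h2 := (abs_le.1 (hφ i (z + v) (z + r⁻¹ • v))).2
      have e2 : z + v - (z + r⁻¹ • v) = (1 - r⁻¹) • v := by module
      have h3 : 0 ≤ 1 - r⁻¹ := sub_nonneg.2 (inv_le_one_of_one_le₀ hr)
      rw [e2, norm_smul, Real.norm_of_nonneg h3] at h2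
      have h4 : r * (1 - r⁻¹) = r - 1 := by field_simp
      have h5 : r * (K * ((1 - r⁻¹) * ‖v‖)) ≤ (r - 1) * θ := by
        have hv' : ‖v‖ ≤ δ := by simpa using (mem_ball.1 hv).le
        calc r * (K * ((1 - r⁻¹) * ‖v‖)) = (r - 1) * (K * ‖v‖) := by rw [← h4]; ring
          _ ≤ _ := mul_le_mul_of_nonneg_left (mul_le_mul_of_nonneg_left hv' hK0.le) (by linarith)
      nlinarith
    have h6 : (r - 1) * θ ≤ (r - 1) * (1 / 4) := mul_le_mul_of_nonneg_left hδ1 (by linarith)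
    linarith
  · have h0 : ∀ x, C.φ i x - A (C.φ i) x = C.φ i (T x) - A (C.φ i) (T x) := fun x => by
      -- With zero displacement, `hTx` compares the coordinates of `x` and `T x`; together with
      -- `hMT` it shows that the error depends only on `T x`.
      have := hTx x 0 (by simpa using hδ) i
      simp only [add_zero] at this
      rw [this, hMT]
      ring
    have h1 : ‖T x - T y‖ ≤ ∑ j, θ * (|C.φ j x - C.φ j y| / max (C.φ j x) (C.φ j y)) := by
      simp only [T]
      rw [← Finset.sum_sub_distrib]
      refine (norm_sum_le _ _).trans (Finset.sum_le_sum fun j _ => ?_)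
      rw [← sub_smul, norm_smul, Real.norm_eq_abs]
      refine le_trans ?_ (abs_min_sub_min_le (C.nonneg j x) (C.nonneg j y) hθ0)
      exact mul_le_of_le_one_right (abs_nonneg _) (C.norm_u_le j)
    rw [← Finset.mul_sum] at h1
    have hS : 0 ≤ ∑ j, |C.φ j x - C.φ j y| / max (C.φ j x) (C.φ j y) :=
      Finset.sum_nonneg fun j _ =>
        div_nonneg (abs_nonneg _) ((C.nonneg j x).trans (le_max_left _ _))
    rw [h0 x, h0 y]
    have h2 := hφ i (T x) (T y)
    have h3 := hlip i (T x) (T y)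
    have h4 := hlip i (T y) (T x)
    rw [norm_sub_rev] at h4
    calc |(C.φ i (T x) - A (C.φ i) (T x)) - (C.φ i (T y) - A (C.φ i) (T y))|
        ≤ 2 * K * ‖T x - T y‖ := by
          rw [abs_le] at h2 ⊢
          constructor <;> linarith
      _ ≤ 2 * K * (θ * ∑ j, |C.φ j x - C.φ j y| / max (C.φ j x) (C.φ j y)) :=
          mul_le_mul_of_nonneg_left h1 (by positivity)
      _ = 2 * K * θ * ∑ j, |C.φ j x - C.φ j y| / max (C.φ j x) (C.φ j y) := by ring
      _ ≤ _ := mul_le_mul_of_nonneg_right hδ2 hS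

end ConicalCoordinates

/-! ### Homogeneous smooth heights of the rays -/

namespace ConicalCoordinates.Smoothing

variable {I V : Type*} [Fintype I] [NormedAddCommGroup V] [NormedSpace ℝ V]
  {C : ConicalCoordinates I V} {η : ℝ} (S : C.Smoothing η)

/-- Once `M i` exceeds 1/2 along a ray from the origin, the radial estimate makes it strictly
increasing. So the ray meets the level 1 at most once, and `f` does not depend on the choice in its
definition. -/
theorem lt_of_lt {i : I} {x : V} {r s : ℝ} (hr : 0 < r) (hrs : r < s)
    (h : 1 / 2 < S.M i (r • x)) : S.M i (r • x) < S.M i (s • x) := by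
  have h1 := S.radial i (r • x) (s / r) ((one_le_div hr).2 hrs.le)
  rw [smul_smul, div_mul_cancel₀ _ hr.ne'] at h1
  have h2 : 0 < s / r - 1 := sub_pos.2 ((one_lt_div hr).2 hrs)
  nlinarith

theorem eq_of_eq {i : I} {x : V} {r s : ℝ} (hr : 0 < r) (hs : 0 < s)
    (h : 1 / 2 < S.M i (r • x)) (h' : S.M i (r • x) = S.M i (s • x)) : r = s := by
  rcases lt_trichotomy r s with h1 | h1 | h1
  · exact absurd h' (S.lt_of_lt hr h1 h).ne
  · exact h1
  · exact absurd h' (S.lt_of_lt hs h1 (h' ▸ h)).ne'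

/-- Intermediate value theorem: scaling `φ i` to 1/2 gives `M i` ≤ 3/4, and scaling it to 2 gives `M
i` ≥ 7/4. -/
theorem exists_eq_one [FiniteDimensional ℝ V] {i : I} {x : V} (hx : 0 < C.φ i x) :
    ∃ c : ℝ, 0 < c ∧ S.M i (c⁻¹ • x) = 1 := by
  have hcont : Continuous fun r : ℝ => S.M i (r • x) :=
    (S.contDiff i).continuous.comp (by fun_prop)
  have hle : 1 / (2 * C.φ i x) ≤ 2 / C.φ i x := by
    rw [div_le_div_iff₀ (by positivity) hx]
    nlinarith
  have h1 : S.M i ((1 / (2 * C.φ i x)) • x) ≤ 1 := by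
    have := (abs_le.1 (S.abs_sub_le i ((1 / (2 * C.φ i x)) • x))).2
    rw [C.apply_smul (by positivity)] at this
    have h2 : 1 / (2 * C.φ i x) * C.φ i x = 1 / 2 := by field_simp
    linarith
  have h2 : 1 ≤ S.M i ((2 / C.φ i x) • x) := by
    have := (abs_le.1 (S.abs_sub_le i ((2 / C.φ i x) • x))).1
    rw [C.apply_smul (by positivity)] at this
    have h2 : 2 / C.φ i x * C.φ i x = 2 := by field_simp
    linarith
  obtain ⟨r, hr, hr1⟩ := intermediate_value_Icc hle hcont.continuousOn ⟨h1, h2⟩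
  have hr0 : 0 < r := lt_of_lt_of_le (by positivity) hr.1
  exact ⟨r⁻¹, inv_pos.2 hr0, by rwa [inv_inv]⟩

open Classical in
/-- The smooth height function of the star of the ray through `u i`: it is homogeneous of degree
one with `{x | f i x = 1} = {x | M i x = 1}`. -/
noncomputable def f (i : I) (x : V) : ℝ :=
  if h : ∃ c : ℝ, 0 < c ∧ S.M i (c⁻¹ • x) = 1 then h.choose else 0

theorem f_eq {i : I} {x : V} {c : ℝ} (hc : 0 < c) (h : S.M i (c⁻¹ • x) = 1) : S.f i x = c := by
  have hex : ∃ c : ℝ, 0 < c ∧ S.M i (c⁻¹ • x) = 1 := ⟨c, hc, h⟩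
  rw [f, dif_pos hex]
  have h1 := hex.choose_spec
  refine inv_injective (S.eq_of_eq (inv_pos.2 h1.1) (inv_pos.2 hc) ?_ (h1.2.trans h.symm))
  rw [h1.2]
  norm_num

/-- The infinitesimal radial estimate: on the level `M i` = 1 the radial derivative is at least 3/4,
so the level set is transverse to the rays. -/
theorem le_fderiv_self (i : I) (z : V) : S.M i z - 1 / 4 ≤ fderiv ℝ (S.M i) z z := by
  have h1 : HasDerivAt (fun t : ℝ => S.M i (t • z)) (fderiv ℝ (S.M i) z z) 1 := by
    have h2 : HasDerivAt (fun t : ℝ => t • z) z 1 := by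
      simpa using (hasDerivAt_id (1 : ℝ)).smul_const z
    have h3 : HasFDerivAt (S.M i) (fderiv ℝ (S.M i) z) ((1 : ℝ) • z) := by
      rw [one_smul]
      exact ((S.contDiff i).differentiable (by simp)).differentiableAt.hasFDerivAt
    exact h3.comp_hasDerivAt 1 h2
  have h2 := (hasDerivWithinAt_iff_tendsto_slope' (s := Ioi 1) (by simp)).1 h1.hasDerivWithinAt
  refine ge_of_tendsto h2 ?_
  filter_upwards [self_mem_nhdsWithin] with t ht
  have ht' : 0 < t - 1 := sub_pos.2 ht
  rw [slope_def_field, le_div_iff₀ ht', one_smul, mul_comm]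
  exact S.radial i z t (le_of_lt ht)

/-- In the directions of a face, the derivative of `M i` is close to the coordinate `i`. -/
theorem abs_fderiv_M_sub_le {A : Finset I} {i : I} (hi : i ∈ A) {z : V} (hz : z ∈ C.star A)
    (hη : 0 ≤ η) (v : I → ℝ) :
    |fderiv ℝ (S.M i) z (∑ j ∈ A, v j • C.u j) - v i| ≤ η * ∑ j ∈ A, |v j| / C.φ j z := by
  classical
  set w := ∑ j ∈ A, v j • C.u j with hw
  have hl : HasDerivAt (fun t : ℝ => z + t • w) w 0 := by
    simpa using ((hasDerivAt_id (0 : ℝ)).smul_const w).const_add z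
  have h1 : HasDerivAt (fun t : ℝ => S.M i (z + t • w) - t * v i)
      (fderiv ℝ (S.M i) z w - v i) 0 := by
    have h2 : HasFDerivAt (S.M i) (fderiv ℝ (S.M i) z) (z + (0 : ℝ) • w) := by
      rw [zero_smul, add_zero]
      exact ((S.contDiff i).differentiable (by simp)).differentiableAt.hasFDerivAt
    have h3 : HasDerivAt (fun t : ℝ => t * v i) (v i) 0 := by
      simpa using (hasDerivAt_id (0 : ℝ)).mul_const (v i)
    exact (h2.comp_hasDerivAt 0 hl).sub h3
  have hsum : 0 ≤ ∑ j ∈ A, |v j| / C.φ j z :=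
    Finset.sum_nonneg fun j _ => div_nonneg (abs_nonneg _) (C.nonneg _ _)
  -- Along the line, `φ i` moves by exactly `t * v i` for small `t`. Up to a constant, the function
  -- differentiated is thus minus the error, and the error estimate bounds its derivative.
  have h2 := h1.hasFDerivAt.le_of_lip' (C := η * ∑ j ∈ A, |v j| / C.φ j z)
    (mul_nonneg hη hsum) ?_
  · simpa using h2
  have hpos : ∀ᶠ t in 𝓝 (0 : ℝ), ∀ j ∈ A, 0 < C.φ j z + t * v j := by
    rw [Finset.eventually_all]
    intro j hj
    have hc : Continuous fun t : ℝ => C.φ j z + t * v j := by fun_prop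
    exact hc.continuousAt.eventually (lt_mem_nhds (by simpa using hz j hj))
  filter_upwards [hpos] with t ht
  have hφ : ∀ j, C.φ j (z + t • w) = C.φ j z + if j ∈ A then t * v j else 0 := by
    intro j
    have e : z + t • w = z + ∑ j, (if j ∈ A then t * v j else 0) • C.u j := by
      simp [hw, ite_smul, Finset.sum_ite_mem, Finset.smul_sum, smul_smul]
    rw [e]
    refine C.apply_add_sum z _ (fun k => ?_) (fun k hk => ?_) j
    · split_ifs with hk
      · exact (ht k hk).le
      · simpa using C.nonneg k z
    · exact if_neg fun hkA => (hz k hkA).ne' hk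
  have h3 := S.error_lipschitz i (z + t • w) z
  have h4 : ∑ j, |C.φ j (z + t • w) - C.φ j z| / max (C.φ j (z + t • w)) (C.φ j z) ≤
      ∑ j ∈ A, |t| * (|v j| / C.φ j z) := by
    rw [← Finset.sum_subset (Finset.subset_univ A) (fun j _ hj => by simp [hφ, hj])]
    refine Finset.sum_le_sum fun j hj => ?_
    rw [hφ, if_pos hj, add_sub_cancel_left, abs_mul, ← mul_div_assoc]
    exact div_le_div_of_nonneg_left (by positivity) (hz j hj) (le_max_right _ _)
  rw [hφ, if_pos hi] at h3
  rw [← Finset.mul_sum] at h4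
  have h5 := h3.trans (mul_le_mul_of_nonneg_left h4 hη)
  simp only [zero_smul, add_zero, zero_mul, sub_zero, Real.norm_eq_abs]
  rw [← abs_neg]
  calc _ = |C.φ i z + t * v i - S.M i (z + t • w) - (C.φ i z - S.M i z)| := by ring_nf
    _ ≤ _ := h5
    _ = _ := by ring

variable [FiniteDimensional ℝ V]

theorem f_pos {i : I} {x : V} (hx : 0 < C.φ i x) : 0 < S.f i x := by
  obtain ⟨c, hc, h⟩ := S.exists_eq_one hx
  rwa [S.f_eq hc h]

theorem M_inv_f_smul {i : I} {x : V} (hx : 0 < C.φ i x) : S.M i ((S.f i x)⁻¹ • x) = 1 := by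
  obtain ⟨c, hc, h⟩ := S.exists_eq_one hx
  rwa [S.f_eq hc h]

theorem f_smul {i : I} {x : V} (hx : 0 < C.φ i x) {t : ℝ} (ht : 0 < t) :
    S.f i (t • x) = t * S.f i x := by
  refine S.f_eq (mul_pos ht (S.f_pos hx)) ?_
  rw [mul_inv, smul_smul, mul_right_comm, inv_mul_cancel₀ ht.ne', one_mul, S.M_inv_f_smul hx]

theorem f_le {i : I} {x : V} (hx : 0 < C.φ i x) : S.f i x ≤ 2 * C.φ i x := by
  have hf := S.f_pos hx
  have := (abs_le.1 (S.abs_sub_le i ((S.f i x)⁻¹ • x))).2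
  rw [S.M_inv_f_smul hx, C.apply_smul (inv_pos.2 hf).le, inv_mul_eq_div] at this
  have h2 : 1 / 2 ≤ C.φ i x / S.f i x := by linarith
  rw [le_div_iff₀ hf] at h2
  linarith

theorem contDiffAt_f {i : I} {x : V} (hx : 0 < C.φ i x) : ContDiffAt ℝ ∞ (S.f i) x := by
  -- Implicit function theorem by way of a left inverse: (y, 1) is the image of (y, 1 / f_i(y))
  -- under `P`, which is injective on `U`.
  let P : V × ℝ → V × ℝ := fun p => (p.1, S.M i (p.2 • p.1))
  have hm : ContDiff ℝ ∞ fun p : V × ℝ => S.M i (p.2 • p.1) :=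
    (S.contDiff i).comp (contDiff_snd.smul contDiff_fst)
  have hP : ContDiff ℝ ∞ P := contDiff_fst.prodMk hm
  let U : Set (V × ℝ) := {p | 0 < p.2 ∧ 1 / 2 < S.M i (p.2 • p.1)}
  have hU : IsOpen U := (isOpen_lt continuous_const continuous_snd).inter
    (isOpen_lt continuous_const hm.continuous)
  have hinj : InjOn P U := by
    rintro ⟨y, r⟩ ⟨hr, hyr⟩ ⟨z, s⟩ ⟨hs, -⟩ h
    obtain ⟨h1, h2⟩ := Prod.mk.inj h
    dsimp only at h1 h2 hr hyr hs
    subst h1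
    rw [S.eq_of_eq hr hs hyr h2]
  have : Nonempty (V × ℝ) := ⟨0⟩
  let g : V × ℝ → V × ℝ := Function.invFunOn P U
  have hg : ∀ p ∈ U, g (P p) = p := hinj.leftInvOn_invFunOn
  have hmem : ∀ y, 0 < C.φ i y → (y, (S.f i y)⁻¹) ∈ U ∧ P (y, (S.f i y)⁻¹) = (y, 1) := by
    intro y hy
    refine ⟨⟨inv_pos.2 (S.f_pos hy), ?_⟩, Prod.ext rfl (S.M_inv_f_smul hy)⟩
    simp only [S.M_inv_f_smul hy]
    norm_num
  have key := contDiffAt_leftInverse rfl hU hg (hmem x hx).1 hP.contDiffAt (by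
    rintro ⟨v, ρ⟩ hv
    set r := (S.f i x)⁻¹
    have hr : 0 < r := (hmem x hx).1.1
    have hd : HasFDerivAt P ((ContinuousLinearMap.fst ℝ V ℝ).prod
        ((fderiv ℝ (S.M i) (r • x)).comp
          (r • ContinuousLinearMap.fst ℝ V ℝ + (ContinuousLinearMap.snd ℝ V ℝ).smulRight x)))
        (x, r) := by
      refine hasFDerivAt_fst.prodMk (HasFDerivAt.comp (x, r) (g := S.M i)
        ((S.contDiff i).differentiable (by simp)).differentiableAt.hasFDerivAt ?_)
      have h1 : HasFDerivAt (Prod.snd : V × ℝ → ℝ) (ContinuousLinearMap.snd ℝ V ℝ) (x, r) :=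
        hasFDerivAt_snd
      have h2 : HasFDerivAt (Prod.fst : V × ℝ → V) (ContinuousLinearMap.fst ℝ V ℝ) (x, r) :=
        hasFDerivAt_fst
      exact h1.smul h2
    rw [hd.fderiv] at hv
    simp only [ContinuousLinearMap.prod_apply, ContinuousLinearMap.coe_fst', Prod.mk_eq_zero,
      ContinuousLinearMap.comp_apply, add_apply, smul_apply,
      ContinuousLinearMap.smulRight_apply, ContinuousLinearMap.coe_snd'] at hv
    obtain ⟨rfl, hv⟩ := hv
    rw [smul_zero, zero_add, map_smul, smul_eq_mul, mul_eq_zero] at hv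
    rcases hv with rfl | hv
    · rfl
    · exfalso
      -- A vanishing derivative of `M i` in the direction `x` contradicts the radial lower bound 1 -
      -- 1/4.
      have h1 := S.le_fderiv_self i (r • x)
      rw [S.M_inv_f_smul hx, map_smul, hv, smul_zero] at h1
      norm_num at h1)
  rw [(hmem x hx).2] at key
  have h1 : ContDiffAt ℝ ∞ (fun y => ((g (y, 1)).2)⁻¹) x := by
    refine ContDiffAt.inv ?_ ?_
    · exact ContDiffAt.snd (ContDiffAt.comp x key (contDiffAt_id.prodMk contDiffAt_const))
    · rw [← (hmem x hx).2, hg _ (hmem x hx).1]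
      exact (inv_pos.2 (S.f_pos hx)).ne'
  refine h1.congr_of_eventuallyEq ?_
  filter_upwards [(isOpen_lt continuous_const (continuous_φ i)).mem_nhds hx] with y hy
  rw [← (hmem y hy).2, hg _ (hmem y hy).1, inv_inv]

/-- Along the level sets of `f i` the function `M i` is constant to first order. -/
theorem fderiv_M_eq_zero {i : I} {x : V} (hx : 0 < C.φ i x) {v : V}
    (hv : fderiv ℝ (S.f i) x v = 0) :
    fderiv ℝ (S.M i) ((S.f i x)⁻¹ • x) v = 0 := by
  have hf := S.f_pos hx
  have hl : HasDerivAt (fun t : ℝ => x + t • v) v 0 := by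
    simpa using ((hasDerivAt_id (0 : ℝ)).smul_const v).const_add x
  have hl0 : x + (0 : ℝ) • v = x := by simp
  have h1 : HasDerivAt (fun t : ℝ => S.f i (x + t • v)) 0 0 := by
    have h2 : HasFDerivAt (S.f i) (fderiv ℝ (S.f i) x) (x + (0 : ℝ) • v) := by
      rw [hl0]
      exact ((S.contDiffAt_f hx).differentiableAt (by simp)).hasFDerivAt
    simpa [Function.comp_def, hv] using h2.comp_hasDerivAt 0 hl
  have h2 : HasDerivAt (fun t : ℝ => (S.f i (x + t • v))⁻¹ • (x + t • v)) ((S.f i x)⁻¹ • v) 0 := by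
    have h := (h1.inv (by simpa using hf.ne')).smul hl
    simp only [zero_smul, add_zero, neg_zero, zero_div, Pi.inv_apply] at h
    exact h
  have h3 : HasDerivAt (fun t : ℝ => S.M i ((S.f i (x + t • v))⁻¹ • (x + t • v)))
      (fderiv ℝ (S.M i) ((S.f i x)⁻¹ • x) ((S.f i x)⁻¹ • v)) 0 := by
    have h4 : HasFDerivAt (S.M i) (fderiv ℝ (S.M i) ((S.f i x)⁻¹ • x))
        ((S.f i (x + (0 : ℝ) • v))⁻¹ • (x + (0 : ℝ) • v)) := by
      rw [hl0]
      exact ((S.contDiff i).differentiable (by simp)).differentiableAt.hasFDerivAt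
    exact h4.comp_hasDerivAt 0 h2
  have h5 : (fun t : ℝ => S.M i ((S.f i (x + t • v))⁻¹ • (x + t • v))) =ᶠ[𝓝 0] fun _ => 1 := by
    have : ∀ᶠ t in 𝓝 (0 : ℝ), 0 < C.φ i (x + t • v) := by
      have hc : Continuous fun t : ℝ => C.φ i (x + t • v) := (continuous_φ i).comp (by fun_prop)
      exact hc.continuousAt.eventually (lt_mem_nhds (by simpa using hx))
    filter_upwards [this] with t ht using S.M_inv_f_smul ht
  have h6 := h3.unique ((hasDerivAt_const (0 : ℝ) (1 : ℝ)).congr_of_eventuallyEq h5)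
  rw [map_smul, smul_eq_mul, mul_eq_zero] at h6
  exact h6.resolve_left (inv_pos.2 hf).ne'

end ConicalCoordinates.Smoothing

/-! ### Heights as coordinates on the cosets of a face -/

/-- This passes from the relative distances in the error estimate to distances between logarithms.
-/
theorem abs_exp_sub_exp_div_max_le (a b : ℝ) :
    |Real.exp a - Real.exp b| / max (Real.exp a) (Real.exp b) ≤ |a - b| := by
  wlog h : a ≤ b generalizing a b
  · rw [abs_sub_comm, abs_sub_comm a, max_comm]
    exact this b a (le_of_not_ge h)
  have h1 := Real.exp_le_exp.2 h
  rw [max_eq_right h1, abs_sub_comm, abs_sub_comm a, abs_of_nonneg (sub_nonneg.2 h),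
    abs_of_nonneg (sub_nonneg.2 h1), sub_div, div_self (Real.exp_pos b).ne', ← Real.exp_sub]
  linarith [Real.add_one_le_exp (a - b)]

theorem abs_log_sub_log_le {a b : ℝ} (ha : 1 / 2 ≤ a) (hb : 1 / 2 ≤ b) :
    |Real.log a - Real.log b| ≤ 2 * |a - b| := by
  wlog h : b ≤ a generalizing a b
  · rw [abs_sub_comm, abs_sub_comm a]
    exact this hb ha (le_of_not_ge h)
  have hb0 : 0 < b := by linarith
  rw [abs_of_nonneg (sub_nonneg.2 h), abs_of_nonneg (sub_nonneg.2 (Real.log_le_log hb0 h)),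
    ← Real.log_div (by linarith) hb0.ne']
  refine (Real.log_le_sub_one_of_pos (div_pos (by linarith) hb0)).trans ?_
  rw [div_sub_one hb0.ne', div_le_iff₀ hb0]
  nlinarith

/-- A finite family of nonnegative numbers that are all small compared to their sum vanishes. -/
theorem eq_zero_of_le_mul_sum {I : Type*} [Fintype I] {A : Finset I} {η : ℝ} (hη : 0 ≤ η)
    (hcard : η * Fintype.card I ≤ 1 / 4) {R : I → ℝ} (hR : ∀ i ∈ A, 0 ≤ R i)
    (h : ∀ i ∈ A, R i ≤ 2 * (η * ∑ j ∈ A, R j)) : ∀ i ∈ A, R i = 0 := by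
  have h0 := Finset.sum_nonneg hR
  have h1 := Finset.sum_le_sum h
  rw [Finset.sum_const, nsmul_eq_mul] at h1
  have h2 : (A.card : ℝ) * η ≤ 1 / 4 := by
    refine le_trans ?_ hcard
    rw [mul_comm]
    exact mul_le_mul_of_nonneg_left (by exact_mod_cast A.card_le_univ) hη
  have h3 : ∑ j ∈ A, R j = 0 := by nlinarith
  exact (Finset.sum_eq_zero_iff_of_nonneg hR).1 h3

namespace ConicalCoordinates

variable {I V : Type*} [Fintype I] [NormedAddCommGroup V] [NormedSpace ℝ V]
  {C : ConicalCoordinates I V} {A : Finset I}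

-- Adding the negative part of `a` to `x` and its positive part to `y` gives the same point. Both
-- additions only increase coordinates that are positive already, so their effect is known.
open Classical in
theorem apply_eq_of_mem_star {x y : V} (hx : x ∈ C.star A) (hy : y ∈ C.star A) {a : I → ℝ}
    (h : x = y + ∑ j ∈ A, a j • C.u j) (i : I) :
    C.φ i x = C.φ i y + if i ∈ A then a i else 0 := by
  have h1 : x + ∑ j, (if j ∈ A then max (-a j) 0 else 0) • C.u j =
      y + ∑ j, (if j ∈ A then max (a j) 0 else 0) • C.u j := by
    simp only [ite_smul, zero_smul, Finset.sum_ite_mem, Finset.univ_inter]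
    rw [h, add_assoc, ← Finset.sum_add_distrib]
    congr 1
    refine Finset.sum_congr rfl fun j _ => ?_
    rw [← add_smul]
    congr 1
    rcases le_total (a j) 0 with h | h
    · rw [max_eq_right h, max_eq_left (by linarith)]; ring
    · rw [max_eq_left h, max_eq_right (by linarith)]; ring
  have key : ∀ z ∈ C.star A, ∀ b : I → ℝ,
      C.φ i (z + ∑ j, (if j ∈ A then max (b j) 0 else 0) • C.u j) =
        C.φ i z + if i ∈ A then max (b i) 0 else 0 := by
    intro z hz b
    refine C.apply_add_sum z _ (fun j => add_nonneg (C.nonneg _ _) ?_) (fun j hj => ?_) i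
    · split_ifs
      exacts [le_max_right _ _, le_rfl]
    · exact if_neg fun hA => (hz j hA).ne' hj
  have h2 := key x hx (fun j => -a j)
  rw [h1, key y hy] at h2
  split_ifs at h2 ⊢ with hi
  · rcases le_total (a i) 0 with h | h
    · rw [max_eq_right h, max_eq_left (by linarith)] at h2; linarith
    · rw [max_eq_left h, max_eq_right (by linarith)] at h2; linarith
  · linarith

/-- Every coset of the span of a face meets the star of the face. -/
theorem IsFace.exists_mem_star [FiniteDimensional ℝ V] (hA : C.IsFace A) (x : V) :
    ∃ r : ℝ, x + ∑ j ∈ A, r • C.u j ∈ C.star A := by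
  -- The sum of the generators lies in the open star, hence so does a perturbation by a small
  -- multiple of `x`; rescaling turns it into a point of the coset of `x`.
  have h0 : (0 : ℝ) • x + ∑ j ∈ A, (1 : ℝ) • C.u j ∈ C.star A := by
    intro i hi
    rw [zero_smul, zero_add, (hA.apply_sum (fun _ => 1) (fun _ _ => zero_le_one) i).1 hi]
    exact zero_lt_one
  have hc : Continuous fun t : ℝ => t • x + ∑ j ∈ A, (1 : ℝ) • C.u j := by fun_prop
  have h1 : ∀ᶠ t in 𝓝[>] (0 : ℝ), t • x + ∑ j ∈ A, (1 : ℝ) • C.u j ∈ C.star A :=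
    (hc.continuousAt.mono_left nhdsWithin_le_nhds).eventually ((isOpen_star A).mem_nhds h0)
  obtain ⟨t, ht, ht0⟩ := (h1.and self_mem_nhdsWithin).exists
  have ht0 : 0 < t := ht0
  refine ⟨t⁻¹, fun i hi => ?_⟩
  have h2 : x + ∑ j ∈ A, t⁻¹ • C.u j = t⁻¹ • (t • x + ∑ j ∈ A, (1 : ℝ) • C.u j) := by
    rw [smul_add, smul_smul, inv_mul_cancel₀ ht0.ne', one_smul]
    simp [Finset.smul_sum]
  rw [h2, C.apply_smul (inv_pos.2 ht0).le]
  exact mul_pos (inv_pos.2 ht0) (ht i hi)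

namespace Smoothing

variable {η : ℝ} (S : C.Smoothing η) [FiniteDimensional ℝ V]

/-- After division by the common height c, `M i` is 1 at both points, so the difference of `φ i`
equals the difference of errors. As c ≤ 2 max(φ_i(x), φ_i(y)), every relative distance is at most 2η
times their sum, which forces them all to vanish. -/
theorem eq_of_f_eq (hη : 0 ≤ η) (hcard : η * Fintype.card I ≤ 1 / 4) {x y : V}
    (hx : x ∈ C.star A) (hy : y ∈ C.star A) {a : I → ℝ}
    (h : x = y + ∑ j ∈ A, a j • C.u j) (hf : ∀ i ∈ A, S.f i x = S.f i y) : x = y := by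
  classical
  have hφ := apply_eq_of_mem_star hx hy h
  let R : I → ℝ := fun j => |C.φ j x - C.φ j y| / max (C.φ j x) (C.φ j y)
  have hRA : ∑ j, R j = ∑ j ∈ A, R j :=
    (Finset.sum_subset (Finset.subset_univ A) fun j _ hj => by simp [R, hφ j, hj]).symm
  have hmax : ∀ i ∈ A, 0 < max (C.φ i x) (C.φ i y) := fun i hi => lt_max_of_lt_left (hx i hi)
  have hR : ∀ i ∈ A, R i ≤ 2 * (η * ∑ j ∈ A, R j) := by
    intro i hi
    set c := S.f i x with hc
    have hc0 : 0 < c := S.f_pos (hx i hi)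
    have h1 := S.error_lipschitz i (c⁻¹ • x) (c⁻¹ • y)
    have h2 : S.M i (c⁻¹ • x) = 1 := S.M_inv_f_smul (hx i hi)
    have h3 : S.M i (c⁻¹ • y) = 1 := by
      rw [hc, hf i hi]
      exact S.M_inv_f_smul (hy i hi)
    rw [h2, h3, sub_sub_sub_cancel_right] at h1
    simp only [C.apply_smul (inv_pos.2 hc0).le, ← mul_sub, abs_mul,
      ← mul_max_of_nonneg _ _ (inv_pos.2 hc0).le, abs_of_pos (inv_pos.2 hc0)] at h1
    have h4 : ∀ j, c⁻¹ * |C.φ j x - C.φ j y| / (c⁻¹ * max (C.φ j x) (C.φ j y)) = R j :=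
      fun j => mul_div_mul_left _ _ (inv_pos.2 hc0).ne'
    simp only [h4] at h1
    rw [hRA, inv_mul_le_iff₀ hc0] at h1
    have h5 : c ≤ 2 * max (C.φ i x) (C.φ i y) :=
      (S.f_le (hx i hi)).trans (by linarith [le_max_left (C.φ i x) (C.φ i y)])
    have h6 : 0 ≤ η * ∑ j ∈ A, R j := mul_nonneg hη (Finset.sum_nonneg fun j hj =>
      div_nonneg (abs_nonneg _) (hmax j hj).le)
    rw [div_le_iff₀ (hmax i hi)]
    nlinarith
  have h0 := eq_zero_of_le_mul_sum hη hcard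
    (fun i hi => div_nonneg (abs_nonneg _) (hmax i hi).le) hR
  rw [← C.sum_smul x, ← C.sum_smul y]
  refine Finset.sum_congr rfl fun j _ => ?_
  by_cases hj : j ∈ A
  · have := h0 j hj
    rw [div_eq_zero_iff, or_iff_left (hmax j hj).ne', abs_eq_zero, sub_eq_zero] at this
    rw [this]
  · rw [hφ j, if_neg hj, add_zero]

theorem exists_f_eq (hη : 0 ≤ η) (hcard : η * Fintype.card I ≤ 1 / 4) (hA : C.IsFace A)
    (x : V) {c : I → ℝ} (hc : ∀ i ∈ A, 0 < c i) :
    ∃ y ∈ C.star A, (∃ a : I → ℝ, y = x + ∑ j ∈ A, a j • C.u j) ∧ ∀ i ∈ A, S.f i y = c i := by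
  classical
  obtain ⟨r, hr⟩ := hA.exists_mem_star x
  set z := x + ∑ j ∈ A, r • C.u j with hz
  -- The unknowns `t` are the logarithms of the coordinates in `A`; the other coordinates stay those
  -- of `z`, so `X t` remains in the coset.
  let s : (A → ℝ) → I → ℝ := fun t j => if h : j ∈ A then Real.exp (t ⟨j, h⟩) else C.φ j z
  let X : (A → ℝ) → V := fun t => ∑ j, s t j • C.u j
  have hφX : ∀ t j, C.φ j (X t) = s t j := by
    intro t j
    refine C.apply_sum z _ (fun j => ?_) (fun j hj => ?_) j
    · simp only [s]
      split_ifs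
      exacts [(Real.exp_pos _).le, C.nonneg _ _]
    · have : j ∉ A := fun h => (hr j h).ne' hj
      simp [s, this, hj]
  have hφX1 : ∀ t (j : A), C.φ j (X t) = Real.exp (t j) := fun t j => by
    rw [hφX]; simp [s]
  let E : I → V → ℝ := fun i y => C.φ i y - S.M i y
  have hE : ∀ i y, 3 / 4 ≤ 1 + E i y := fun i y => by
    have := (abs_le.1 (S.abs_sub_le i y)).2
    simp only [E]
    linarith
  -- The equation f_i(X) = c_i means M_i(X / c_i) = 1, that is φ_i(X) = c_i (1 + E_i(X / c_i)); `T`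
  -- is the logarithm of the right side. Its Lipschitz constant is 2 · 1/4, since log is 2-Lipschitz
  -- on [1/2, ∞).
  let T : (A → ℝ) → A → ℝ := fun t i =>
    Real.log (c i) + Real.log (1 + E i ((c i)⁻¹ • X t))
  have hT : ContractingWith (1 / 2) T := by
    refine ⟨by norm_num, LipschitzWith.of_dist_le_mul fun t t' => ?_⟩
    rw [dist_pi_le_iff (by positivity)]
    intro i
    have hci := inv_pos.2 (hc i i.2)
    have h1 := S.error_lipschitz i ((c i)⁻¹ • X t) ((c i)⁻¹ • X t')
    have h2 : ∑ j, |C.φ j ((c i)⁻¹ • X t) - C.φ j ((c i)⁻¹ • X t')| /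
        max (C.φ j ((c i)⁻¹ • X t)) (C.φ j ((c i)⁻¹ • X t')) ≤ Fintype.card I * dist t t' := by
      rw [← nsmul_eq_mul, ← Finset.card_univ, ← Finset.sum_const]
      refine Finset.sum_le_sum fun j _ => ?_
      rw [C.apply_smul hci.le, C.apply_smul hci.le, ← mul_sub, abs_mul, abs_of_pos hci,
        ← mul_max_of_nonneg _ _ hci.le, mul_div_mul_left _ _ hci.ne', hφX, hφX]
      by_cases hj : j ∈ A
      · simp only [s, hj, dite_true]
        refine (abs_exp_sub_exp_div_max_le _ _).trans ?_
        rw [← Real.dist_eq]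
        exact dist_le_pi_dist t t' ⟨j, hj⟩
      · simp [s, hj]
    have h3 := abs_log_sub_log_le (a := 1 + E i ((c i)⁻¹ • X t))
      (b := 1 + E i ((c i)⁻¹ • X t')) (by linarith [hE i ((c i)⁻¹ • X t)])
      (by linarith [hE i ((c i)⁻¹ • X t')])
    rw [add_sub_add_left_eq_sub] at h3
    have h4 := h1.trans (mul_le_mul_of_nonneg_left h2 hη)
    rw [Real.dist_eq]
    simp only [T, add_sub_add_left_eq_sub]
    have h5 : η * (Fintype.card I * dist t t') ≤ 1 / 4 * dist t t' := by
      rw [← mul_assoc]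
      exact mul_le_mul_of_nonneg_right hcard dist_nonneg
    have h6 : ((1 / 2 : NNReal) : ℝ) = 1 / 2 := by norm_num
    rw [h6]
    linarith
  let t := ContractingWith.fixedPoint T hT
  have ht : T t = t := hT.fixedPoint_isFixedPt
  refine ⟨X t, fun i hi => ?_, ⟨fun j => r + (s t j - C.φ j z), ?_⟩, fun i hi => ?_⟩
  · rw [hφX1 t ⟨i, hi⟩]
    exact Real.exp_pos _
  · have h1 : X t = z + ∑ j ∈ A, (s t j - C.φ j z) • C.u j := by
      have h2 : ∑ j ∈ A, (s t j - C.φ j z) • C.u j = ∑ j, (s t j - C.φ j z) • C.u j :=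
        Finset.sum_subset (Finset.subset_univ A) fun j _ hj => by simp [s, hj]
      rw [h2]
      simp_rw [sub_smul, Finset.sum_sub_distrib, C.sum_smul, add_sub_cancel, X]
    rw [h1, hz, add_assoc, ← Finset.sum_add_distrib]
    simp_rw [← add_smul]
  · refine S.f_eq (hc i hi) ?_
    have h1 := congrFun ht ⟨i, hi⟩
    have h2 := hφX1 t ⟨i, hi⟩
    have h3 := hE i ((c i)⁻¹ • X t)
    rw [← h1] at h2
    simp only [T] at h2
    rw [Real.exp_add, Real.exp_log (hc i hi), Real.exp_log (by linarith)] at h2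
    have h4 : C.φ i ((c i)⁻¹ • X t) = 1 + E i ((c i)⁻¹ • X t) := by
      rw [C.apply_smul (inv_pos.2 (hc i hi)).le, h2, inv_mul_cancel_left₀ (hc i hi).ne']
    simp only [E] at h4
    linarith

/-- The infinitesimal form of `eq_of_f_eq`, with |v_j| / φ_j(x) in place of relative distances. -/
theorem eq_zero_of_fderiv_f_eq_zero (hη : 0 ≤ η) (hcard : η * Fintype.card I ≤ 1 / 4) {x : V}
    (hx : x ∈ C.star A) {v : I → ℝ}
    (hv : ∀ i ∈ A, fderiv ℝ (S.f i) x (∑ j ∈ A, v j • C.u j) = 0) : ∀ i ∈ A, v i = 0 := by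
  let R : I → ℝ := fun j => |v j| / C.φ j x
  have hR : ∀ i ∈ A, R i ≤ 2 * (η * ∑ j ∈ A, R j) := by
    intro i hi
    have hc := S.f_pos (hx i hi)
    have hz : (S.f i x)⁻¹ • x ∈ C.star A := fun j hj => by
      rw [C.apply_smul (inv_pos.2 hc).le]
      exact mul_pos (inv_pos.2 hc) (hx j hj)
    have h1 := S.abs_fderiv_M_sub_le hi hz hη v
    rw [S.fderiv_M_eq_zero (hx i hi) (hv i hi), zero_sub, abs_neg] at h1
    have h2 : ∑ j ∈ A, |v j| / C.φ j ((S.f i x)⁻¹ • x) = S.f i x * ∑ j ∈ A, R j := by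
      rw [Finset.mul_sum]
      refine Finset.sum_congr rfl fun j _ => ?_
      rw [C.apply_smul (inv_pos.2 hc).le]
      simp only [R]
      field_simp
    have h3 : 0 ≤ η * ∑ j ∈ A, R j := mul_nonneg hη (Finset.sum_nonneg fun j hj =>
      div_nonneg (abs_nonneg _) (hx j hj).le)
    rw [h2] at h1
    have h4 := S.f_le (hx i hi)
    rw [div_le_iff₀ (hx i hi)]
    nlinarith
  have h0 := eq_zero_of_le_mul_sum hη hcard
    (fun i hi => div_nonneg (abs_nonneg _) (hx i hi).le) hR
  intro i hi
  have := h0 i hi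
  rwa [div_eq_zero_iff, or_iff_left (hx i hi).ne', abs_eq_zero] at this

end Smoothing

end ConicalCoordinates

/-! ### Smooth inverse of the heights and the projections -/

namespace ConicalCoordinates

variable {I V : Type*} [Fintype I] [NormedAddCommGroup V] [NormedSpace ℝ V]
  {C : ConicalCoordinates I V} {A : Finset I}

theorem IsFace.dual_u {l : I → V →L[ℝ] ℝ}
    (hl : ∀ i ∈ A, ∀ s : I → ℝ, l i (∑ j ∈ A, s j • C.u j) = s i)
    {i : I} (hi : i ∈ A) (x : V) (s : I → ℝ) :
    l i (x + ∑ j ∈ A, s j • C.u j) = l i x + s i := by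
  rw [map_add, hl i hi]

variable [FiniteDimensional ℝ V]

/-- The point with prescribed heights `f i`, `i ∈ A`, and prescribed class modulo the span of `A`
depends smoothly on these data. -/
theorem Smoothing.exists_smooth_inverse {η : ℝ} (S : C.Smoothing η) (hη : 0 ≤ η)
    (hcard : η * Fintype.card I ≤ 1 / 4) (hA : C.IsFace A) {l : I → V →L[ℝ] ℝ}
    (hl : ∀ i ∈ A, ∀ s : I → ℝ, l i (∑ j ∈ A, s j • C.u j) = s i) :
    ∃ Ψ : V → V, ∀ y, (∀ i ∈ A, 0 < l i y) → ContDiffAt ℝ ∞ Ψ y ∧ Ψ y ∈ C.star A ∧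
      (∃ a : I → ℝ, Ψ y = y + ∑ j ∈ A, a j • C.u j) ∧ ∀ i ∈ A, S.f i (Ψ y) = l i y := by
  -- `Φ` keeps the class modulo the span of `A` and makes the linear coordinates `l i` equal to the
  -- heights; `Ψ` is its inverse on the star.
  let Φ : V → V := fun x => x + ∑ i ∈ A, (S.f i x - l i x) • C.u i
  have hlΦ : ∀ x, ∀ i ∈ A, l i (Φ x) = S.f i x := fun x i hi => by
    rw [IsFace.dual_u hl hi]; ring
  have hinj : InjOn Φ (C.star A) := by
    intro x hx y hy hxy
    have h1 : x = y + ∑ i ∈ A, ((S.f i y - l i y) - (S.f i x - l i x)) • C.u i := by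
      have h2 : x + ∑ i ∈ A, (S.f i x - l i x) • C.u i =
        y + ∑ i ∈ A, (S.f i y - l i y) • C.u i := hxy
      simp_rw [sub_smul _ (S.f _ x - l _ x), Finset.sum_sub_distrib]
      rw [← add_sub_assoc, ← h2, add_sub_cancel_right]
    refine S.eq_of_f_eq hη hcard hx hy h1 fun i hi => ?_
    rw [← hlΦ x i hi, ← hlΦ y i hi, hxy]
  have hsurj : ∀ y, (∀ i ∈ A, 0 < l i y) → ∃ x ∈ C.star A, Φ x = y ∧
      ∃ a : I → ℝ, x = y + ∑ j ∈ A, a j • C.u j := by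
    intro y hy
    obtain ⟨x, hx, ⟨a, ha⟩, hf⟩ := S.exists_f_eq hη hcard hA y hy
    refine ⟨x, hx, ?_, a, ha⟩
    have h1 : ∑ i ∈ A, (S.f i x - l i x) • C.u i = -∑ i ∈ A, a i • C.u i := by
      rw [← Finset.sum_neg_distrib]
      refine Finset.sum_congr rfl fun i hi => ?_
      rw [hf i hi, ha, IsFace.dual_u hl hi, ← neg_smul]
      congr 1
      ring
    simp only [Φ]
    rw [h1, ← sub_eq_add_neg, sub_eq_iff_eq_add]
    exact ha
  have hleft := hinj.leftInvOn_invFunOn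
  refine ⟨Function.invFunOn Φ (C.star A), fun y hy => ?_⟩
  obtain ⟨x, hx, hxy, ha⟩ := hsurj y hy
  have hΨ : Function.invFunOn Φ (C.star A) y = x := by rw [← hxy]; exact hleft hx
  rw [hΨ]
  refine ⟨?_, hx, ha, fun i hi => by rw [← hlΦ x i hi, hxy]⟩
  rw [← hxy]
  have hfd : ∀ i ∈ A, HasFDerivAt (S.f i) (fderiv ℝ (S.f i) x) x := fun i hi =>
    ((S.contDiffAt_f (hx i hi)).differentiableAt (by simp)).hasFDerivAt
  have hd : HasFDerivAt Φ (ContinuousLinearMap.id ℝ V +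
      ∑ i ∈ A, (fderiv ℝ (S.f i) x - l i).smulRight (C.u i)) x := by
    refine (hasFDerivAt_id x).add (HasFDerivAt.fun_sum fun i hi => ?_)
    exact ((hfd i hi).sub (l i).hasFDerivAt).smul_const (C.u i)
  refine contDiffAt_leftInverse rfl (isOpen_star A) hleft hx ?_ fun v hv => ?_
  · refine contDiffAt_id.add (ContDiffAt.sum fun i hi => ?_)
    exact ((S.contDiffAt_f (hx i hi)).sub (l i).contDiff.contDiffAt).smul contDiffAt_const
  · rw [hd.fderiv] at hv
    simp only [add_apply, ContinuousLinearMap.id_apply, sum_apply,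
      ContinuousLinearMap.smulRight_apply, sub_apply] at hv
    have h1 : ∀ i ∈ A, fderiv ℝ (S.f i) x v = 0 := fun i hi => by
      have := congrArg (l i) hv
      rw [IsFace.dual_u hl hi, map_zero] at this
      linarith
    have h2 : v = ∑ i ∈ A, l i v • C.u i := by
      rw [Finset.sum_congr rfl fun i hi => by rw [h1 i hi, zero_sub, neg_smul],
        Finset.sum_neg_distrib, ← sub_eq_add_neg, sub_eq_zero] at hv
      exact hv
    have h3 := S.eq_zero_of_fderiv_f_eq_zero hη hcard hx (v := fun i => l i v) (by rwa [← h2])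
    rw [h2]
    exact Finset.sum_eq_zero fun i hi => by rw [h3 i hi, zero_smul]

variable (C) in
/-- Coherent projections for the faces of a system of conical coordinates. The map `g` is the
inverse of the quotient map restricted to a fibre. -/
theorem exists_coherent_projections :
    ∃ π : Finset I → V → V, ∀ A, C.IsFace A →
      (∀ x ∈ C.star A, ∀ j, 0 < C.φ j (π A x) ↔ j ∈ A) ∧
      ContDiffOn ℝ ∞ (π A) (C.star A) ∧
      (∀ b, (∀ j, 0 < C.φ j b ↔ j ∈ A) → ∃ g : V → V, ContDiff ℝ ∞ g ∧
        (∀ x, g x ∈ C.star A ∧ π A (g x) = b ∧ ∃ a : I → ℝ, g x = x + ∑ j ∈ A, a j • C.u j) ∧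
        ∀ x y, ∀ a : I → ℝ, x ∈ C.star A → π A x = b → y = x + ∑ j ∈ A, a j • C.u j → g y = x) ∧
      (∀ B, C.IsFace B → A ⊆ B → ∀ x ∈ C.star B, π A (π B x) = π A x) ∧
      ∀ t : ℝ, 0 < t → ∀ x ∈ C.star A, π A (t • x) = t • π A x := by
  classical
  obtain ⟨η, hη, hcard⟩ : ∃ η : ℝ, 0 < η ∧ η * Fintype.card I ≤ 1 / 4 := by
    -- The added 1 keeps the denominator positive when there are no rays.
    refine ⟨1 / (4 * (Fintype.card I + 1)), by positivity, ?_⟩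
    rw [div_mul_eq_mul_div, div_le_iff₀ (by positivity)]
    linarith
  obtain ⟨S⟩ := C.exists_smoothing hη
  choose! l hl using fun (A : Finset I) (hA : C.IsFace A) => hA.exists_dual
  choose! Ψ hΨ using fun (A : Finset I) (hA : C.IsFace A) =>
    S.exists_smooth_inverse hη.le hcard hA (hl A hA)
  -- The argument of `Ψ A` lies in the span of `A`, so the result is the point of the span with the
  -- heights of `x`.
  let π : Finset I → V → V := fun A x => Ψ A (∑ j ∈ A, S.f j x • C.u j)
  have hpos : ∀ A, C.IsFace A → ∀ x ∈ C.star A, ∀ i ∈ A,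
      0 < l A i (∑ j ∈ A, S.f j x • C.u j) := fun A hA x hx i hi => by
    rw [hl A hA i hi]
    exact S.f_pos (hx i hi)
  have hmem : ∀ A, C.IsFace A → ∀ x ∈ C.star A, π A x ∈ C.star A := fun A hA x hx =>
    (hΨ A hA _ (hpos A hA x hx)).2.1
  have hspan : ∀ A, C.IsFace A → ∀ x ∈ C.star A, ∃ a : I → ℝ, π A x = ∑ j ∈ A, a j • C.u j := by
    intro A hA x hx
    obtain ⟨a, ha⟩ := (hΨ A hA _ (hpos A hA x hx)).2.2.1
    refine ⟨fun j => S.f j x + a j, ha.trans ?_⟩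
    simp_rw [add_smul, Finset.sum_add_distrib]
  have hfπ : ∀ A, C.IsFace A → ∀ x ∈ C.star A, ∀ i ∈ A, S.f i (π A x) = S.f i x :=
    fun A hA x hx i hi => by
      rw [(hΨ A hA _ (hpos A hA x hx)).2.2.2 i hi, hl A hA i hi]
  have hcongr : ∀ A x y, (∀ i ∈ A, S.f i x = S.f i y) → π A x = π A y := fun A x y h => by
    simp only [π]
    rw [Finset.sum_congr rfl fun j hj => by rw [h j hj]]
  have huniq : ∀ A, C.IsFace A → ∀ x ∈ C.star A, ∀ b ∈ C.star A, ∀ a : I → ℝ,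
      b = ∑ j ∈ A, a j • C.u j → (∀ i ∈ A, S.f i x = S.f i b) → π A x = b := by
    intro A hA x hx b hb a hab hf
    obtain ⟨a', ha'⟩ := hspan A hA x hx
    refine S.eq_of_f_eq hη.le hcard (a := fun j => a' j - a j) (hmem A hA x hx) hb ?_
      fun i hi => (hfπ A hA x hx i hi).trans (hf i hi)
    simp_rw [sub_smul, Finset.sum_sub_distrib]
    rw [ha', hab, add_sub_cancel]
  refine ⟨π, fun A hA => ⟨fun x hx j => ?_, fun x hx => ?_, fun b hb => ?_,
    fun B hB hAB x hx => ?_, fun t ht x hx => ?_⟩⟩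
  · refine ⟨fun h => ?_, fun h => hmem A hA x hx j h⟩
    by_contra hj
    obtain ⟨z, hz⟩ := hA
    have hA' : C.IsFace A := ⟨z, hz⟩
    obtain ⟨a, ha⟩ := hspan A hA' x hx
    have hzs : z ∈ C.star A := fun i hi => (hz i).2 hi
    -- Both points lie in the star and in the span of `A`, so their coordinates outside `A` agree,
    -- and those of `z` vanish there.
    have h1 : π A x = z + ∑ j ∈ A, (a j - C.φ j z) • C.u j := by
      simp_rw [sub_smul, Finset.sum_sub_distrib]
      rw [sum_support (A := A) fun j hj => le_antisymm (not_lt.1 (mt (hz j).1 hj)) (C.nonneg j z),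
        add_sub_cancel, ha]
    have h2 := apply_eq_of_mem_star (hmem A hA' x hx) hzs h1 j
    rw [if_neg hj, add_zero] at h2
    exact hj ((hz j).1 (h2 ▸ h))
  · refine ContDiffAt.contDiffWithinAt (ContDiffAt.comp x (hΨ A hA _ (hpos A hA x hx)).1 ?_)
    exact ContDiffAt.sum fun i hi => (S.contDiffAt_f (hx i hi)).smul contDiffAt_const
  · have hbs : b ∈ C.star A := fun i hi => (hb i).2 hi
    have hbsum := sum_support (A := A) (x := b) (C := C) fun j hj =>
      le_antisymm (not_lt.1 (mt (hb j).1 hj)) (C.nonneg j b)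
    -- `F x` is the point of the coset of `x` whose linear coordinates are the heights of `b`; `Ψ A`
    -- carries it to the point of that coset in the fibre over `b`.
    let F : V → V := fun x => x + ∑ j ∈ A, (S.f j b - l A j x) • C.u j
    have hF : ∀ x, ∀ i ∈ A, l A i (F x) = S.f i b := fun x i hi => by
      rw [IsFace.dual_u (hl A hA) hi]; ring
    have hFpos : ∀ x, ∀ i ∈ A, 0 < l A i (F x) := fun x i hi => by
      rw [hF x i hi]; exact S.f_pos (hbs i hi)
    have hgspan : ∀ x, ∃ a : I → ℝ, Ψ A (F x) = x + ∑ j ∈ A, a j • C.u j := fun x => by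
      obtain ⟨a, ha⟩ := (hΨ A hA _ (hFpos x)).2.2.1
      refine ⟨fun j => (S.f j b - l A j x) + a j, ha.trans ?_⟩
      simp_rw [add_smul _ (a _), Finset.sum_add_distrib, ← add_assoc]
      rfl
    have hgf : ∀ x, ∀ i ∈ A, S.f i (Ψ A (F x)) = S.f i b := fun x i hi => by
      rw [(hΨ A hA _ (hFpos x)).2.2.2 i hi, hF x i hi]
    refine ⟨fun x => Ψ A (F x), contDiff_iff_contDiffAt.2 fun x => ?_, fun x => ?_,
      fun x y a hx hxb hy => ?_⟩
    · refine ContDiffAt.comp x (hΨ A hA _ (hFpos x)).1 ?_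
      refine contDiffAt_id.add (ContDiffAt.sum fun i hi => ?_)
      exact (contDiffAt_const.sub (l A i).contDiff.contDiffAt).smul contDiffAt_const
    · have h1 := (hΨ A hA _ (hFpos x)).2.1
      exact ⟨h1, huniq A hA _ h1 b hbs _ hbsum.symm (hgf x), hgspan x⟩
    · obtain ⟨a', ha'⟩ := hgspan y
      refine S.eq_of_f_eq hη.le hcard (a := fun j => a j + a' j) (hΨ A hA _ (hFpos y)).2.1 hx ?_
        fun i hi => ?_
      · refine ha'.trans ?_
        rw [hy, add_assoc, ← Finset.sum_add_distrib]
        simp_rw [← add_smul]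
      · rw [← hfπ A hA x hx i hi, hxb]
        exact hgf y i hi
  · exact hcongr A _ _ fun i hi => hfπ B hB x hx i (hAB hi)
  · have htx : t • x ∈ C.star A := fun i hi => by
      rw [C.apply_smul ht.le]
      exact mul_pos ht (hx i hi)
    obtain ⟨a, ha⟩ := hspan A hA x hx
    refine huniq A hA _ htx _ (fun i hi => ?_) (fun j => t * a j) ?_ fun i hi => ?_
    · rw [C.apply_smul ht.le]
      exact mul_pos ht (hmem A hA x hx i hi)
    · rw [ha, Finset.smul_sum]
      simp_rw [smul_smul]
    · rw [S.f_smul (hx i hi) ht, S.f_smul (hmem A hA x hx i hi) ht, hfπ A hA x hx i hi]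

end ConicalCoordinates

/-! ### From complete simplicial fans to conical coordinates -/

/-- Normalisation gives each ray a single generator, shared by all cones containing the ray. -/
theorem PointedCone.IsSimplicial.exists_unit_generators {V : Type*} [NormedAddCommGroup V]
    [NormedSpace ℝ V] {σ : PointedCone ℝ V} (hσ : σ.IsSimplicial) :
    ∃ s : Set V, s.Finite ∧ LinearIndependent ℝ (fun v : s => (v : V)) ∧ (∀ v ∈ s, ‖v‖ = 1) ∧
      PointedCone.hull ℝ s = σ := by
  obtain ⟨s, hs, hli, rfl⟩ := hσ
  have hli : LinearIndependent ℝ (fun v : s => (v : V)) := hli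
  have hn : ∀ v : s, 0 < ‖(v : V)‖ := fun v => norm_pos_iff.2 (hli.ne_zero v)
  let w : s → V := fun v => ‖(v : V)‖⁻¹ • (v : V)
  have hw : LinearIndependent ℝ w :=
    hli.units_smul fun v => Units.mk0 ‖(v : V)‖⁻¹ (inv_pos.2 (hn v)).ne'
  have := hs.to_subtype
  refine ⟨range w, finite_range w, hw.linearIndepOn_id, ?_, le_antisymm ?_ ?_⟩
  · rintro _ ⟨v, rfl⟩
    exact norm_smul_inv_norm (hli.ne_zero v)
  · refine Submodule.span_le.2 ?_
    rintro _ ⟨v, rfl⟩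
    exact PointedCone.smul_mem _ (inv_pos.2 (hn v)).le (PointedCone.subset_hull v.2)
  · refine Submodule.span_le.2 fun v hv => ?_
    have h1 : v = ‖v‖ • w ⟨v, hv⟩ := by
      simp only [w]
      rw [smul_smul, mul_inv_cancel₀ (hn ⟨v, hv⟩).ne', one_smul]
    rw [SetLike.mem_coe, h1]
    exact PointedCone.smul_mem _ (norm_nonneg v) (PointedCone.subset_hull ⟨_, rfl⟩)

theorem PointedCone.dual_of_mem_hull_range {ι V : Type*} [Fintype ι] [DecidableEq ι]
    [AddCommGroup V] [Module ℝ V] {v : ι → V} {l : ι → V →ₗ[ℝ] ℝ}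
    (hl : ∀ i j, l i (v j) = if j = i then 1 else 0) {x : V}
    (hx : x ∈ PointedCone.hull ℝ (range v)) :
    (∀ i, 0 ≤ l i x) ∧ ∑ i, l i x • v i = x := by
  induction hx using Submodule.span_induction with
  | mem x hx =>
    obtain ⟨j, rfl⟩ := hx
    refine ⟨fun i => ?_, ?_⟩
    · rw [hl]; split_ifs <;> norm_num
    · simp [hl]
  | zero => simp
  | add x y _ _ hx hy =>
    refine ⟨fun i => ?_, ?_⟩
    · rw [map_add]; exact add_nonneg (hx.1 i) (hy.1 i)
    · simp_rw [map_add, add_smul, Finset.sum_add_distrib]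
      rw [hx.2, hy.2]
  | smul a x _ hx =>
    have h1 : a • x = (a : ℝ) • x := rfl
    refine ⟨fun i => ?_, ?_⟩
    · rw [h1, map_smul]; exact mul_nonneg a.2 (hx.1 i)
    · simp_rw [h1, map_smul, smul_eq_mul, mul_smul, ← Finset.smul_sum]
      rw [hx.2]

namespace SimplicialFan

variable {V : Type*} [NormedAddCommGroup V] [NormedSpace ℝ V] (S : SimplicialFan V)

/-- The unit vectors that span the rays of the fan. -/
def Ray : Type _ := {u : V // ‖u‖ = 1 ∧ PointedCone.hull ℝ {u} ∈ S.cones}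

variable {S}

/-- The direction of a ray. -/
def Ray.dir (i : S.Ray) : V := i.1

theorem Ray.norm_dir (i : S.Ray) : ‖i.dir‖ = 1 := i.2.1

theorem mem_hull_singleton {u x : V} : x ∈ PointedCone.hull ℝ {u} ↔ ∃ r : ℝ, 0 ≤ r ∧ r • u = x := by
  rw [Submodule.mem_span_singleton]
  exact ⟨fun ⟨a, ha⟩ => ⟨a, a.2, ha⟩, fun ⟨r, hr, h⟩ => ⟨⟨r, hr⟩, h⟩⟩

theorem Ray.dir_mem_hull (i : S.Ray) : i.dir ∈ PointedCone.hull ℝ {i.dir} :=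
  PointedCone.subset_hull rfl

theorem Ray.eq_of_norm_eq_one {i : S.Ray} {v : V} (hv : ‖v‖ = 1)
    (h : v ∈ PointedCone.hull ℝ {i.dir}) : v = i.dir := by
  obtain ⟨r, hr, rfl⟩ := mem_hull_singleton.1 h
  rw [norm_smul, i.norm_dir, mul_one, Real.norm_of_nonneg hr] at hv
  rw [hv, one_smul]

theorem Ray.finite : Finite S.Ray := by
  have := S.finite_cones.to_subtype
  refine Finite.of_injective (fun i : S.Ray => (⟨_, i.2.2⟩ : S.cones)) fun i j hij => ?_
  have h1 : PointedCone.hull ℝ {i.dir} = PointedCone.hull ℝ {j.dir} := congrArg Subtype.val hij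
  exact Subtype.ext (Ray.eq_of_norm_eq_one i.norm_dir (h1 ▸ i.dir_mem_hull))

noncomputable instance : Fintype S.Ray := @Fintype.ofFinite _ Ray.finite

variable {σ τ : PointedCone ℝ V}

/-- A cone of a simplicial fan is generated by the independent unit vectors on its rays. -/
theorem linearIndependent_rays (hσ : σ ∈ S.cones) :
    LinearIndependent ℝ (fun i : {i : S.Ray // i.dir ∈ σ} => i.1.dir) ∧
      PointedCone.hull ℝ (range fun i : {i : S.Ray // i.dir ∈ σ} => i.1.dir) = σ := by
  classical
  obtain ⟨s, hs, hli, hn, hhull⟩ := (S.isSimplicial σ hσ).exists_unit_generators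
  have := hs.fintype
  obtain ⟨l, hl⟩ := hli.exists_dual_family
  have hmem : ∀ x ∈ σ, (∀ i, 0 ≤ l i x) ∧ ∑ i, l i x • (i : V) = x := fun x hx =>
    PointedCone.dual_of_mem_hull_range (v := fun v : s => (v : V)) (fun i j => by convert hl i j)
      (by rw [Subtype.range_coe]; rwa [hhull])
  have hsσ : ∀ v : s, (v : V) ∈ σ := fun v => hhull ▸ PointedCone.subset_hull v.2
  have hface : ∀ v : s, PointedCone.IsFaceOf (PointedCone.hull ℝ {(v : V)}) σ := by
    intro v
    refine ⟨Submodule.span_le.2 (singleton_subset_iff.2 (hsσ v)), fun {x y a} hx hy ha h => ?_⟩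
    obtain ⟨r, hr, hxy⟩ := mem_hull_singleton.1 h
    refine mem_hull_singleton.2 ⟨l v x, (hmem x hx).1 v, ?_⟩
    have h0 : ∀ w, w ≠ v → l w x • (w : V) = 0 := by
      intro w hw
      have h1 := congrArg (l w) hxy
      rw [map_smul, hl, if_neg hw.symm, smul_zero, map_add, map_smul, smul_eq_mul] at h1
      have h2 := (hmem x hx).1 w
      have h3 := (hmem y hy).1 w
      have h4 : l w x = 0 := by
        have : a * l w x ≤ 0 := by linarith
        exact le_antisymm (nonpos_of_mul_nonpos_right this ha) h2
      rw [h4, zero_smul]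
    rw [← Fintype.sum_eq_single v h0]
    exact (hmem x hx).2
  -- A ray of the fan inside σ is a face of σ. Some generator of σ has positive coefficient in its
  -- direction, so the face contains that generator and, being a ray, is spanned by it.
  have hray : ∀ i : S.Ray, i.dir ∈ σ → i.dir ∈ s := by
    intro i hi
    have h1 : PointedCone.IsFaceOf (PointedCone.hull ℝ {i.dir}) σ := by
      have h2 : PointedCone.hull ℝ {i.dir} ⊓ σ = PointedCone.hull ℝ {i.dir} :=
        inf_eq_left.2 (Submodule.span_le.2 (singleton_subset_iff.2 hi))
      have := (S.inter_isFaceOf _ i.2.2 σ hσ).2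
      rwa [show PointedCone.hull ℝ {i.1} ⊓ σ = PointedCone.hull ℝ {i.dir} from h2] at this
    obtain ⟨hpos, hsum⟩ := hmem _ hi
    have hex : ∃ v, 0 < l v i.dir := by
      by_contra! hcon
      have h0 : i.dir = 0 := by
        rw [← hsum]
        exact Finset.sum_eq_zero fun v _ => by rw [le_antisymm (hcon v) (hpos v), zero_smul]
      have := i.norm_dir
      rw [h0, norm_zero] at this
      exact zero_ne_one this
    obtain ⟨v, hv⟩ := hex
    have h2 := h1.mem_of_sum_smul_mem (f := fun v : s => (v : V)) (c := fun v => l v i.dir) hsσ hpos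
      (by rw [hsum]; exact i.dir_mem_hull) v hv
    rw [← Ray.eq_of_norm_eq_one (hn v v.2) h2]
    exact v.2
  refine ⟨?_, le_antisymm ?_ ?_⟩
  · exact hli.comp (fun i : {i : S.Ray // i.dir ∈ σ} => (⟨i.1.dir, hray i.1 i.2⟩ : s))
      fun i j hij => Subtype.ext (Subtype.ext (congrArg (fun v : s => (v : V)) hij))
  · refine Submodule.span_le.2 ?_
    rintro _ ⟨i, rfl⟩
    exact i.2
  · conv_lhs => rw [← hhull]
    refine Submodule.span_mono fun v hv => ?_
    exact ⟨⟨⟨v, hn v hv, S.face_mem σ hσ _ (hface ⟨v, hv⟩)⟩, hsσ ⟨v, hv⟩⟩, rfl⟩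

open Classical in
/-- Linear functionals that compute the coordinates of the points of a cone of the fan. -/
theorem exists_dual (hσ : σ ∈ S.cones) :
    ∃ l : S.Ray → V →ₗ[ℝ] ℝ, (∀ i, i.dir ∉ σ → l i = 0) ∧
      (∀ i j : S.Ray, j.dir ∈ σ → l i j.dir = if j = i then 1 else 0) ∧
      ∀ x ∈ σ, (∀ i, 0 ≤ l i x) ∧ ∑ i, l i x • i.dir = x := by
  obtain ⟨hli, hhull⟩ := linearIndependent_rays hσ
  obtain ⟨l, hl⟩ := hli.exists_dual_family
  refine ⟨fun i => if h : i.dir ∈ σ then l ⟨i, h⟩ else 0, fun i hi => dif_neg hi,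
    fun i j hj => ?_, fun x hx => ?_⟩
  · by_cases hi : i.dir ∈ σ
    · simp only [hi, dite_true]
      rw [hl ⟨i, hi⟩ ⟨j, hj⟩]
      simp
    · have : j ≠ i := fun h => hi (h ▸ hj)
      simp [hi, this]
  · obtain ⟨h1, h2⟩ := PointedCone.dual_of_mem_hull_range
      (fun i j => by convert hl i j) (hhull.symm ▸ hx)
    refine ⟨fun i => ?_, ?_⟩
    · dsimp only
      split_ifs
      exacts [h1 _, le_rfl]
    · conv_rhs => rw [← h2]
      rw [← Finset.sum_subset (Finset.subset_univ (Finset.univ.filter fun i : S.Ray => i.dir ∈ σ))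
        (fun i _ hi => by
          have : i.dir ∉ σ := by simpa using hi
          simp [this]),
        Finset.sum_subtype (p := fun i : S.Ray => i.dir ∈ σ) _ (fun i => by simp)]
      exact Finset.sum_congr rfl fun i _ => by simp [i.2]

/-- `c` is the family of coordinates of `x` with respect to some cone of the fan. -/
def IsCoords (S : SimplicialFan V) (x : V) (c : S.Ray → ℝ) : Prop :=
  (∀ i, 0 ≤ c i) ∧ ∑ i, c i • i.dir = x ∧ ∃ σ ∈ S.cones, ∀ i, c i ≠ 0 → i.dir ∈ σ

theorem isCoords_dual (hσ : σ ∈ S.cones) {l : S.Ray → V →ₗ[ℝ] ℝ}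
    (hl0 : ∀ i, i.dir ∉ σ → l i = 0)
    (hl : ∀ x ∈ σ, (∀ i, 0 ≤ l i x) ∧ ∑ i, l i x • i.dir = x) {x : V} (hx : x ∈ σ) :
    S.IsCoords x (fun i => l i x) := by
  refine ⟨(hl x hx).1, (hl x hx).2, σ, hσ, fun i hi => ?_⟩
  by_contra h
  exact hi (by simp [hl0 i h])

/-- The coordinates may come from another cone σ, but σ ⊓ τ is a face of σ containing `x`, hence
contains every summand of `x`. This is what makes coordinates independent of the cone. -/
theorem IsCoords.mem_of_mem {x : V} {c : S.Ray → ℝ} (hc : S.IsCoords x c) (hτ : τ ∈ S.cones)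
    (hx : x ∈ τ) {i : S.Ray} (hi : c i ≠ 0) : i.dir ∈ τ := by
  obtain ⟨h0, hsum, σ, hσ, hcσ⟩ := hc
  have hmem : ∀ j, c j • j.dir ∈ σ := fun j => by
    by_cases hj : c j = 0
    · rw [hj, zero_smul]; exact σ.zero_mem
    · exact PointedCone.smul_mem _ (h0 j) (hcσ j hj)
  have hxσ : x ∈ σ := hsum ▸ σ.sum_mem fun j _ => hmem j
  have h1 := (S.inter_isFaceOf σ hσ τ hτ).1.mem_of_sum_mem hmem (by rw [hsum]; exact ⟨hxσ, hx⟩) i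
  have h2 := PointedCone.smul_mem τ (inv_nonneg.2 (h0 i)) h1.2
  rwa [smul_smul, inv_mul_cancel₀ hi, one_smul] at h2

theorem IsCoords.eq {x : V} {c d : S.Ray → ℝ} (hc : S.IsCoords x c) (hd : S.IsCoords x d) :
    c = d := by
  classical
  obtain ⟨σ, hσ, hdσ⟩ := hd.2.2
  have hxσ : x ∈ σ := hd.2.1 ▸ σ.sum_mem fun j _ => by
    by_cases hj : d j = 0
    · rw [hj, zero_smul]; exact σ.zero_mem
    · exact PointedCone.smul_mem _ (hd.1 j) (hdσ j hj)
  obtain ⟨l, hl0, hl, -⟩ := exists_dual hσ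
  have key : ∀ e : S.Ray → ℝ, (∀ i, e i ≠ 0 → i.dir ∈ σ) → ∑ i, e i • i.dir = x →
      ∀ i, e i = l i x := by
    intro e he hsum i
    rw [← hsum, map_sum, Finset.sum_eq_single i]
    · by_cases hi : e i = 0
      · rw [hi, zero_smul, map_zero]
      · rw [map_smul, hl i i (he i hi), if_pos rfl, smul_eq_mul, mul_one]
    · intro j _ hj
      by_cases hj0 : e j = 0
      · rw [hj0, zero_smul, map_zero]
      · rw [map_smul, hl i j (he j hj0), if_neg hj, smul_zero]
    · simp
  funext i
  rw [key c (fun i hi => hc.mem_of_mem hσ hxσ hi) hc.2.1, key d hdσ hd.2.1]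

theorem IsComplete.exists_isCoords (hS : S.IsComplete) (x : V) : ∃ c, S.IsCoords x c := by
  obtain ⟨σ, hσ, hx⟩ := hS x
  obtain ⟨l, hl0, -, hl⟩ := exists_dual hσ
  exact ⟨_, isCoords_dual hσ hl0 hl hx⟩

/-- The piecewise linear coordinates of a complete simplicial fan. -/
noncomputable def coordinates (hS : S.IsComplete) : ConicalCoordinates S.Ray V where
  u := Ray.dir
  φ i x := (hS.exists_isCoords x).choose i
  norm_u_le i := i.norm_dir.le
  nonneg i x := (hS.exists_isCoords x).choose_spec.1 i
  sum_smul x := (hS.exists_isCoords x).choose_spec.2.1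
  apply_sum x s hs h i := by
    obtain ⟨σ, hσ, hx⟩ := (hS.exists_isCoords x).choose_spec.2.2
    have h1 : S.IsCoords (∑ j, s j • j.dir) s := ⟨hs, rfl, σ, hσ, fun j hj => hx j (mt (h j) hj)⟩
    exact congrFun ((hS.exists_isCoords _).choose_spec.eq h1) i

theorem coordinates_eq (hS : S.IsComplete) {x : V} {c : S.Ray → ℝ} (hc : S.IsCoords x c)
    (i : S.Ray) : (coordinates hS).φ i x = c i :=
  congrFun ((hS.exists_isCoords x).choose_spec.eq hc) i

open Classical in
/-- The rays of a cone. -/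
noncomputable def rays (S : SimplicialFan V) (σ : PointedCone ℝ V) : Finset S.Ray :=
  Finset.univ.filter fun i => i.dir ∈ σ

theorem mem_rays {i : S.Ray} : i ∈ S.rays σ ↔ i.dir ∈ σ := by simp [rays]

theorem mem_iff_coordinates (hS : S.IsComplete) (hσ : σ ∈ S.cones) {x : V} :
    x ∈ σ ↔ ∀ i ∉ S.rays σ, (coordinates hS).φ i x = 0 := by
  constructor
  · intro hx i hi
    obtain ⟨l, hl0, -, hl⟩ := exists_dual hσ
    rw [coordinates_eq hS (isCoords_dual hσ hl0 hl hx), hl0 i (mt mem_rays.2 hi),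
      LinearMap.zero_apply]
  · intro h
    rw [← ConicalCoordinates.sum_support h]
    exact σ.sum_mem fun j hj =>
      PointedCone.smul_mem _ ((coordinates hS).nonneg _ _) (mem_rays.1 hj)

theorem isFace_rays (hS : S.IsComplete) (hσ : σ ∈ S.cones) :
    (coordinates hS).IsFace (S.rays σ) := by
  classical
  refine ⟨∑ i, (if i ∈ S.rays σ then (1 : ℝ) else 0) • i.dir, fun j => ?_⟩
  rw [coordinates_eq hS (c := fun i => if i ∈ S.rays σ then (1 : ℝ) else 0)]
  · split_ifs with h <;> simp [h]
  · refine ⟨fun i => by dsimp only; split_ifs <;> norm_num, rfl, σ, hσ, fun i hi => ?_⟩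
    by_contra h
    exact hi (if_neg (mt mem_rays.1 h))

/-- The set of rays on which a point has positive coordinates is the set of rays of a cone. -/
theorem exists_cone_of_support (hS : S.IsComplete) (x : V) :
    ∃ τ ∈ S.cones, ∀ j, 0 < (coordinates hS).φ j x ↔ j ∈ S.rays τ := by
  classical
  obtain ⟨σ, hσ, hx⟩ := hS x
  obtain ⟨l, hl0, hl1, hl⟩ := exists_dual hσ
  have hφ := coordinates_eq hS (isCoords_dual hσ hl0 hl hx)
  -- `W` cuts out the smallest face of σ containing `x`: the points whose coordinates vanish
  -- wherever those of `x` do.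
  let W : Submodule ℝ V := ⨅ i ∈ {i : S.Ray | l i x = 0}, LinearMap.ker (l i)
  have hmem : ∀ y, y ∈ σ ⊓ PointedCone.ofSubmodule W ↔ y ∈ σ ∧ ∀ i, l i x = 0 → l i y = 0 := by
    intro y
    simp [W, Submodule.mem_iInf]
  refine ⟨σ ⊓ PointedCone.ofSubmodule W, S.face_mem σ hσ _ ⟨inf_le_left, ?_⟩, fun j => ?_⟩
  · intro y z a hy hz ha h
    rw [hmem] at h ⊢
    refine ⟨hy, fun i hi => ?_⟩
    have h1 := h.2 i hi
    rw [map_add, map_smul, smul_eq_mul] at h1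
    have h2 := (hl y hy).1 i
    have h3 := (hl z hz).1 i
    have : a * l i y ≤ 0 := by linarith
    exact le_antisymm (nonpos_of_mul_nonpos_right this ha) h2
  · rw [mem_rays, hmem, hφ]
    constructor
    · intro hj
      have hjσ : j.dir ∈ σ := by
        by_contra h
        rw [hl0 j h] at hj
        exact lt_irrefl _ hj
      refine ⟨hjσ, fun i hi => ?_⟩
      rw [hl1 i j hjσ, if_neg]
      rintro rfl
      exact hj.ne' hi
    · rintro ⟨hjσ, h⟩
      refine lt_of_le_of_ne ((hl x hx).1 j) fun h0 => ?_
      have := h j h0.symm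
      rw [hl1 j j hjσ, if_pos rfl] at this
      exact one_ne_zero this

theorem rays_subset_rays (hS : S.IsComplete) (hσ : σ ∈ S.cones) (hτ : τ ∈ S.cones) :
    S.rays σ ⊆ S.rays τ ↔ σ ≤ τ := by
  constructor
  · intro h x hx
    rw [mem_iff_coordinates hS hσ] at hx
    rw [mem_iff_coordinates hS hτ]
    exact fun i hi => hx i (mt (@h i) hi)
  · exact fun h i hi => mem_rays.2 (h (mem_rays.1 hi))

theorem mem_linSpan_iff (hσ : σ ∈ S.cones) {x : V} :
    x ∈ linSpan σ ↔ ∃ a : S.Ray → ℝ, x = ∑ i ∈ S.rays σ, a i • i.dir := by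
  classical
  constructor
  · intro hx
    obtain ⟨l, hl0, -, hl⟩ := exists_dual hσ
    refine ⟨fun i => l i x, ?_⟩
    have h1 : linSpan σ ≤ LinearMap.eqLocus LinearMap.id
        (∑ i ∈ S.rays σ, (l i).smulRight i.dir) := by
      refine Submodule.span_le.2 fun y hy => ?_
      simp only [SetLike.mem_coe, LinearMap.mem_eqLocus, LinearMap.id_apply, LinearMap.sum_apply,
        LinearMap.smulRight_apply]
      conv_lhs => rw [← (hl y hy).2]
      refine (Finset.sum_subset (Finset.subset_univ _) fun i _ hi => ?_).symm
      rw [hl0 i (mt mem_rays.2 hi), LinearMap.zero_apply, zero_smul]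
    simpa using h1 hx
  · rintro ⟨a, rfl⟩
    exact Submodule.sum_mem _ fun i hi =>
      Submodule.smul_mem _ _ (Submodule.subset_span (mem_rays.1 hi))

variable [FiniteDimensional ℝ V]

/-- From a relative interior point a small multiple of any generator of σ can be subtracted without
leaving σ, so its coordinate is positive. Conversely, within the affine span, positivity of the dual
functionals is an open condition that implies membership in σ. -/
theorem mem_relint_iff (hS : S.IsComplete) (hσ : σ ∈ S.cones) {x : V} :
    x ∈ relint σ ↔ ∀ j, 0 < (coordinates hS).φ j x ↔ j ∈ S.rays σ := by
  classical
  obtain ⟨l, hl0, hl1, hl⟩ := exists_dual hσ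
  have hφ : ∀ y ∈ σ, ∀ i, (coordinates hS).φ i y = l i y := fun y hy =>
    coordinates_eq hS (isCoords_dual hσ hl0 hl hy)
  have hsub : ∀ y ∈ σ, y ∈ affineSpan ℝ (σ : Set V) := fun y hy => subset_affineSpan ℝ _ hy
  rw [relint, mem_intrinsicInterior]
  constructor
  · rintro ⟨y, hy, rfl⟩ j
    have hyσ : y ∈ ((↑) ⁻¹' (σ : Set V) : Set (affineSpan ℝ (σ : Set V))) := interior_subset hy
    replace hyσ : (y : V) ∈ σ := hyσ
    constructor
    · intro hj
      by_contra hjσ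
      exact hj.ne' ((mem_iff_coordinates hS hσ).1 hyσ j hjσ)
    · intro hj
      have hmem : ∀ t : ℝ, (y : V) - t • j.dir ∈ affineSpan ℝ (σ : Set V) := fun t => by
        have := AffineSubspace.smul_vsub_vadd_mem _ (-t) (hsub _ (mem_rays.1 hj))
          (hsub 0 σ.zero_mem) y.2
        rw [vsub_eq_sub, sub_zero, vadd_eq_add, neg_smul, neg_add_eq_sub] at this
        exact this
      have hc : Continuous fun t : ℝ => (⟨(y : V) - t • j.dir, hmem t⟩ : affineSpan ℝ (σ : Set V)) :=
        Continuous.subtype_mk (by fun_prop) _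
      have h0 : (⟨(y : V) - (0 : ℝ) • j.dir, hmem 0⟩ : affineSpan ℝ (σ : Set V)) = y :=
        Subtype.ext (by simp)
      have h1 : ∀ᶠ t in 𝓝[>] (0 : ℝ), (y : V) - t • j.dir ∈ σ := by
        have h2 := hc.continuousAt (x := 0)
        rw [ContinuousAt, h0] at h2
        filter_upwards [(h2.mono_left nhdsWithin_le_nhds).eventually (isOpen_interior.mem_nhds hy)]
          with t ht
        have h3 : _ ∈ ((↑) ⁻¹' (σ : Set V) : Set (affineSpan ℝ (σ : Set V))) := interior_subset ht
        exact h3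
      obtain ⟨t, ht, ht0⟩ := (h1.and self_mem_nhdsWithin).exists
      have h3 := (hl _ ht).1 j
      rw [map_sub, map_smul, hl1 j j (mem_rays.1 hj), if_pos rfl, smul_eq_mul, mul_one] at h3
      rw [hφ _ hyσ]
      exact lt_of_lt_of_le ht0 (sub_nonneg.1 h3)
  · intro hx
    have hxσ : x ∈ σ := (mem_iff_coordinates hS hσ).2 fun i hi =>
      le_antisymm (not_lt.1 (mt (hx i).1 hi)) ((coordinates hS).nonneg i x)
    refine ⟨⟨x, hsub x hxσ⟩, mem_interior.2
      ⟨{y | ∀ i ∈ S.rays σ, 0 < l i (y : V)}, fun y hy => ?_, ?_, ?_⟩, rfl⟩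
    · have h1 : (y : V) ∈ linSpan σ := affineSpan_le_toAffineSubspace_span y.2
      obtain ⟨a, ha⟩ := (mem_linSpan_iff hσ).1 h1
      have hla : ∀ i ∈ S.rays σ, l i (y : V) = a i := fun i hi => by
        rw [ha, map_sum, Finset.sum_eq_single_of_mem i hi]
        · rw [map_smul, hl1 i i (mem_rays.1 hi), if_pos rfl, smul_eq_mul, mul_one]
        · intro j hj hji
          rw [map_smul, hl1 i j (mem_rays.1 hj), if_neg hji, smul_zero]
      rw [mem_preimage, SetLike.mem_coe, ha]
      exact σ.sum_mem fun i hi => PointedCone.smul_mem _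
        (hla i hi ▸ (hy i hi).le) (mem_rays.1 hi)
    · have : {y : affineSpan ℝ (σ : Set V) | ∀ i ∈ S.rays σ, 0 < l i (y : V)} =
          ⋂ i ∈ S.rays σ, {y : affineSpan ℝ (σ : Set V) | 0 < l i (y : V)} := by ext; simp
      rw [this]
      exact isOpen_biInter_finset fun i _ => isOpen_lt continuous_const
        ((l i).continuous_of_finiteDimensional.comp continuous_subtype_val)
    · intro i hi
      change 0 < l i x
      rw [← hφ x hxσ]
      exact (hx i).2 hi

theorem star_eq (hS : S.IsComplete) (hσ : σ ∈ S.cones) :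
    S.star σ = (coordinates hS).star (S.rays σ) := by
  ext x
  constructor
  · rintro ⟨τ, hτ, hστ, hx⟩ i hi
    exact ((mem_relint_iff hS hτ).1 hx i).2 ((rays_subset_rays hS hσ hτ).2 hστ hi)
  · intro hx
    obtain ⟨τ, hτ, h⟩ := exists_cone_of_support hS x
    exact ⟨τ, hτ, (rays_subset_rays hS hσ hτ).1 fun i hi => (h i).1 (hx i hi),
      (mem_relint_iff hS hτ).2 h⟩

end SimplicialFan

theorem mainTheorem10 {V : Type*} [NormedAddCommGroup V] [NormedSpace ℝ V]
    [FiniteDimensional ℝ V] (S : SimplicialFan V) (hS : S.IsComplete) :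
    ∃ π : PointedCone ℝ V → V → V,
      S.IsCoherentProjections π ∧ S.IsHomogeneousDegreeOne π := by
  obtain ⟨π, hπ⟩ := (SimplicialFan.coordinates hS).exists_coherent_projections
  have hface : ∀ {σ}, σ ∈ S.cones → (SimplicialFan.coordinates hS).IsFace (S.rays σ) :=
    SimplicialFan.isFace_rays hS
  refine ⟨fun σ => π (S.rays σ), ⟨fun σ hσ _ x hx => ?_, fun σ hσ _ x hx => ?_,
    fun σ hσ _ b hb => ?_, fun σ hσ τ hτ _ hστ x hx => ?_⟩, fun σ hσ _ t ht x hx => ?_⟩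
  · rw [SimplicialFan.star_eq hS hσ] at hx
    exact (SimplicialFan.mem_relint_iff hS hσ).2 ((hπ _ (hface hσ)).1 x hx)
  · rw [SimplicialFan.star_eq hS hσ] at hx ⊢
    exact ⟨_, ConicalCoordinates.isOpen_star _, hx, _, (hπ _ (hface hσ)).2.1,
      fun y _ => rfl⟩
  · obtain ⟨g, hg, hg1, hg2⟩ :=
      (hπ _ (hface hσ)).2.2.1 b ((SimplicialFan.mem_relint_iff hS hσ).1 hb)
    rw [SimplicialFan.star_eq hS hσ]
    let W := SimplicialFan.linSpan σ
    -- `g` is constant on cosets of ℝσ only along the fibre condition's uniqueness, so a linear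
    -- section `r` of the quotient map suffices: `g ∘ r` is the smooth inverse on the fibre.
    obtain ⟨r, hr⟩ := W.mkQ.exists_rightInverse_of_surjective W.range_mkQ
    have hr' : ∀ q, W.mkQ (r q) = q := fun q => LinearMap.congr_fun hr q
    have hmk : ∀ x y, W.mkQ x = W.mkQ y ↔
        ∃ a : S.Ray → ℝ, x = y + ∑ i ∈ S.rays σ, a i • i.dir := by
      intro x y
      rw [Submodule.mkQ_apply, Submodule.mkQ_apply, Submodule.Quotient.eq,
        SimplicialFan.mem_linSpan_iff hσ]
      simp_rw [sub_eq_iff_eq_add']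
    have hq : ∀ q, W.mkQ (g (r q)) = q := fun q =>
      ((hmk _ _).2 (hg1 (r q)).2.2).trans (hr' q)
    refine ⟨fun x _ => ⟨univ, isOpen_univ, mem_univ _, _,
      (LinearMap.toContinuousLinearMap W.mkQ).contDiff.contDiffOn, fun y _ => rfl⟩,
      fun _ _ => mem_univ _, fun q => g (r q), fun q _ => ⟨univ, isOpen_univ, mem_univ _, _,
      (hg.comp (LinearMap.toContinuousLinearMap r).contDiff).contDiffOn, fun y _ => rfl⟩,
      fun q _ => ⟨(hg1 (r q)).1, (hg1 (r q)).2.1⟩, fun x hx => ?_, fun q _ => hq q⟩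
    obtain ⟨a, ha⟩ := (hmk (r (W.mkQ x)) x).1 (hr' _)
    exact hg2 x _ a hx.1 hx.2 ha
  · rw [SimplicialFan.star_eq hS hτ] at hx
    exact (hπ _ (hface hσ)).2.2.2.1 _ (hface hτ)
      ((SimplicialFan.rays_subset_rays hS hσ hτ).2 hστ) x hx
  · rw [SimplicialFan.star_eq hS hσ] at hx
    exact (hπ _ (hface hσ)).2.2.2.2 t ht x hx
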